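/- Let $(\Omega,\mathcal F,\mathbb P)$ be a probability space, $T>0$ and $H\in(\tfrac12,1)$. Let $W=(W_t)_{t\in[0,T]}$ be a standard Brownian motion and $B^H=(B^H_t)_{t\in[0,T]}$ a fractional Brownian motion with Hurst parameter $H$ (a centred Gaussian process with almost surely continuous paths and covariance $\tfrac12(s^{2H}+t^{2H}-|t-s|^{2H})$), independent of $W$, and let $X=W+B^H$. Let $\xi$ be a square integrable real random variable with a density $g_\xi$, independent of the filtration generated by $X$. For $t\in[0,T]$ and $x\in\mathbb R$ let $$\phi_W(t,x)=\int_0^t e^{ix(t-s)}\,dW_s := W_t+ix\int_0^t e^{ix(t-s)}W_s\,ds ,$$ the pathwise integral defined by integration by parts. Then, almost surely: (0) for all $t\in[0,T]$ and $x\in\mathbb R$, $\phi_W(t,x)$ is the Riemann--Stieltjes integral of $s\mapsto e^{ix(t-s)}$ against $W$ over $[0,t]$; (1) for every $x\in\mathbb R$ the integral $\int_0^T\phi_W(t,x)\,dB^H_t$ exists as a Riemann--Stieltjes integral, and $x\mapsto\big(\int_0^T\phi_W(t,x)\,dB^H_t\big)g_\xi(x)$ is Lebesgue integrable on $\mathbb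 R$; (2) for every $t\in[0,T]$ the function $x\mapsto\phi_W(t,x)g_\xi(x)$ is Lebesgue integrable on $\mathbb R$, and $t\mapsto\int_{\mathbb R}\phi_W(t,x)g_\xi(x)\,dx$ has a Riemann--Stieltjes integral against $B^H$ over $[0,T]$; (3) the two iterated integrals agree: $$\int_{\mathbb R}\Big(\int_0^T\phi_W(t,x)\,dB^H_t\Big)g_\xi(x)\,dx=\int_0^T\Big(\int_{\mathbb R}\phi_W(t,x)g_\xi(x)\,dx\Big)dB^H_t .$$ Here a Riemann--Stieltjes integral is the limit, path by path, of the Riemann--Stieltjes sums with arbitrary tags as the mesh of the partition tends to $0$. -/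

import Mathlib

open MeasureTheory ProbabilityTheory Set

/-- `W` is a standard Brownian motion on `[0,T]`: a centred Gaussian process with covariance
`min s t` and almost surely continuous paths. Only the values `W t` with `t ∈ [0,T]` matter. -/
structure IsStandardBrownianMotionOn {Ω : Type*} [MeasurableSpace Ω]
    (W : ℝ → Ω → ℝ) (T : ℝ) (P : Measure Ω) : Prop where
  gaussian : IsGaussianProcess (fun (t : Icc (0 : ℝ) T) ω => W t ω) P
  mean_zero : ∀ t ∈ Icc (0 : ℝ) T, ∫ ω, W t ω ∂P = 0
  covariance : ∀ s ∈ Icc (0 : ℝ) T, ∀ t ∈ Icc (0 : ℝ) T, cov[W s, W t; P] = min s t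
  continuous : ∀ᵐ ω ∂P, ContinuousOn (fun t => W t ω) (Icc 0 T)

/-- `B` is a fractional Brownian motion on `[0,T]` with Hurst parameter `H`: a centred Gaussian
process with covariance `(s ^ (2H) + t ^ (2H) - |t - s| ^ (2H)) / 2` and almost surely continuous
paths. Only the values `B t` with `t ∈ [0,T]` matter. -/
structure IsFractionalBrownianMotionOn {Ω : Type*} [MeasurableSpace Ω]
    (B : ℝ → Ω → ℝ) (H T : ℝ) (P : Measure Ω) : Prop where
  gaussian : IsGaussianProcess (fun (t : Icc (0 : ℝ) T) ω => B t ω) P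
  mean_zero : ∀ t ∈ Icc (0 : ℝ) T, ∫ ω, B t ω ∂P = 0
  covariance : ∀ s ∈ Icc (0 : ℝ) T, ∀ t ∈ Icc (0 : ℝ) T,
    cov[B s, B t; P] = (s ^ (2 * H) + t ^ (2 * H) - |t - s| ^ (2 * H)) / 2
  continuous : ∀ᵐ ω ∂P, ContinuousOn (fun t => B t ω) (Icc 0 T)

/-- The points `τ 0 ≤ τ 1 ≤ ⋯ ≤ τ n` form a partition of `[a,b]` of mesh less than `δ`, and
`σ i ∈ [τ i, τ (i+1)]` are tags for it. (Repeated points contribute nothing to the sums.) -/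
structure IsTaggedPartition (a b δ : ℝ) (n : ℕ) (τ σ : ℕ → ℝ) : Prop where
  left : τ 0 = a
  right : τ n = b
  le_tag : ∀ i < n, τ i ≤ σ i
  tag_le : ∀ i < n, σ i ≤ τ (i + 1)
  mesh : ∀ i < n, τ (i + 1) - τ i < δ

/-- The Riemann–Stieltjes sum `∑ f(σ i) (g(τ (i+1)) - g(τ i))`. -/
noncomputable def rsSum (f : ℝ → ℂ) (g : ℝ → ℝ) (n : ℕ) (τ σ : ℕ → ℝ) : ℂ :=
  ∑ i ∈ Finset.range n, f (σ i) * ((g (τ (i + 1)) - g (τ i) : ℝ) : ℂ)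

/-- The Riemann–Stieltjes integral of `f` against `g` over `[a,b]` exists and equals `z`: the
Riemann–Stieltjes sums, with arbitrary tags, converge to `z` as the mesh tends to `0`. -/
def HasRSIntegral (f : ℝ → ℂ) (g : ℝ → ℝ) (a b : ℝ) (z : ℂ) : Prop :=
  ∀ ε > 0, ∃ δ > 0, ∀ (n : ℕ) (τ σ : ℕ → ℝ),
    IsTaggedPartition a b δ n τ σ → ‖rsSum f g n τ σ - z‖ < ε

/-- The Riemann–Stieltjes integral of `f` against `g` over `[a,b]` exists. -/
def RSIntegrable (f : ℝ → ℂ) (g : ℝ → ℝ) (a b : ℝ) : Prop :=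
  ∃ z, HasRSIntegral f g a b z

open scoped Classical in
/-- The value of the Riemann–Stieltjes integral (`0` if it does not exist). -/
noncomputable def rsIntegral (f : ℝ → ℂ) (g : ℝ → ℝ) (a b : ℝ) : ℂ :=
  if h : RSIntegrable f g a b then h.choose else 0

theorem exists_isTaggedPartition {a b δ : ℝ} (hab : a ≤ b) (hδ : 0 < δ) :
    ∃ n τ σ, IsTaggedPartition a b δ n τ σ := by
  obtain ⟨n, hn⟩ := exists_nat_gt ((b - a) / δ)
  have hn0 : (0 : ℝ) < n := lt_of_le_of_lt (div_nonneg (sub_nonneg.2 hab) hδ.le) hn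
  have hs : ∀ i : ℕ, (a + ((i + 1 : ℕ) : ℝ) * ((b - a) / n)) - (a + (i : ℝ) * ((b - a) / n))
      = (b - a) / n := by
    intro i
    push_cast
    ring
  have hq : 0 ≤ (b - a) / n := div_nonneg (sub_nonneg.2 hab) hn0.le
  refine ⟨n, fun i => a + (i : ℝ) * ((b - a) / n), fun i => a + (i : ℝ) * ((b - a) / n), ?_⟩
  refine ⟨by simp, ?_, fun i _ => le_rfl, fun i _ => ?_, fun i _ => ?_⟩
  · change a + (n : ℝ) * ((b - a) / n) = b
    field_simp
    ring
  · have := hs i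
    linarith
  · simp only [hs i]
    rw [div_lt_iff₀ hδ] at hn
    rw [div_lt_iff₀ hn0]
    linarith

theorem IsTaggedPartition.mono {a b δ δ' : ℝ} {n : ℕ} {τ σ : ℕ → ℝ}
    (h : IsTaggedPartition a b δ n τ σ) (hδ : δ ≤ δ') : IsTaggedPartition a b δ' n τ σ :=
  ⟨h.left, h.right, h.le_tag, h.tag_le, fun i hi => (h.mesh i hi).trans_le hδ⟩

/-- The value of a Riemann–Stieltjes integral is unique. -/
theorem HasRSIntegral.unique {f : ℝ → ℂ} {g : ℝ → ℝ} {a b : ℝ} {z w : ℂ} (hab : a ≤ b)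
    (hz : HasRSIntegral f g a b z) (hw : HasRSIntegral f g a b w) : z = w := by
  by_contra hne
  have hpos : 0 < ‖z - w‖ / 2 := half_pos (norm_pos_iff.2 (sub_ne_zero.2 hne))
  obtain ⟨δ₁, h₁, H₁⟩ := hz _ hpos
  obtain ⟨δ₂, h₂, H₂⟩ := hw _ hpos
  obtain ⟨n, τ, σ, h⟩ := exists_isTaggedPartition hab (lt_min h₁ h₂)
  have A := H₁ n τ σ (h.mono (min_le_left _ _))
  have B := H₂ n τ σ (h.mono (min_le_right _ _))
  have C : ‖z - w‖ ≤ ‖rsSum f g n τ σ - w‖ + ‖rsSum f g n τ σ - z‖ := by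
    have := norm_sub_le (rsSum f g n τ σ - w) (rsSum f g n τ σ - z)
    rwa [sub_sub_sub_cancel_left] at this
  linarith

theorem HasRSIntegral.rsIntegral_eq {f : ℝ → ℂ} {g : ℝ → ℝ} {a b : ℝ} {z : ℂ} (hab : a ≤ b)
    (hz : HasRSIntegral f g a b z) : rsIntegral f g a b = z := by
  have h : RSIntegrable f g a b := ⟨z, hz⟩
  rw [rsIntegral, dif_pos h]
  exact h.choose_spec.unique hab hz

/-- The pathwise integral `∫₀ᵗ e^{iλs} dw_s` of a path `w` with `w 0 = 0`, defined by
integration by parts as `e^{iλt} w_t - iλ ∫₀ᵗ w_s e^{iλs} ds`. -/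
noncomputable def pathExpIntegral (lam : ℝ) (w : ℝ → ℝ) (t : ℝ) : ℂ :=
  Complex.exp (Complex.I * lam * t) * w t
    - Complex.I * lam * ∫ s in (0 : ℝ)..t, (w s : ℂ) * Complex.exp (Complex.I * lam * s)

/-- `φ_w(t,x) = ∫₀ᵗ e^{ix(t-s)} dw_s = e^{ixt} ∫₀ᵗ e^{-ixs} dw_s`. -/
noncomputable def phiPath (w : ℝ → ℝ) (t x : ℝ) : ℂ :=
  Complex.exp (Complex.I * x * t) * pathExpIntegral (-x) w t

/-!
Brownian paths are `α`-Hölder for every `α < 1/2`, fractional Brownian paths `β`-Hölder for every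
`β < H`, and `H > 1/2` leaves room for `α + β > 1`; hence the Young integral `∫₀ᵀ W dB` exists
pathwise: deleting the partition points one at a time bounds Riemann–Stieltjes sums by Hölder
constants, so `W` may be replaced by its continuously differentiable Steklov averages, which
converge to it in every weaker Hölder norm. Since `∂ₜ(φ_W(t,x) - W_t) = i x φ_W(t,x)`, the
function `φ_W(·,x)` differs from `W` by an absolutely continuous function, against which
Riemann–Stieltjes integration turns into an ordinary Lebesgue integral:
`∫₀ᵀ φ_W(t,x) dB_t = ∫₀ᵀ W dB + ∫₀ᵀ (B_T - B_s) i x φ_W(s,x) ds`.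
The first summand does not depend on `x`, and classical Fubini applies to the second, because
`|x φ_W(s,x)| ≤ C (1 + x²)` and the weight has a second moment.
-/

open Filter Topology
open scoped ENNReal NNReal

section TaggedPartitions

variable {a b δ : ℝ} {n : ℕ} {τ σ : ℕ → ℝ}

theorem IsTaggedPartition.le_succ (h : IsTaggedPartition a b δ n τ σ) {i : ℕ} (hi : i < n) :
    τ i ≤ τ (i + 1) :=
  (h.le_tag i hi).trans (h.tag_le i hi)

theorem IsTaggedPartition.point_mem (h : IsTaggedPartition a b δ n τ σ) {i : ℕ} (hi : i ≤ n) :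
    τ i ∈ Icc a b := by
  constructor
  · rw [← h.left]
    induction i with
    | zero => exact le_rfl
    | succ k ih => exact (ih (by omega)).trans (h.le_succ hi)
  · rw [← h.right]
    induction hi using Nat.decreasingInduction with
    | self => exact le_rfl
    | of_succ k hk ih => exact (h.le_succ hk).trans ih

theorem IsTaggedPartition.tag_mem (h : IsTaggedPartition a b δ n τ σ) {i : ℕ} (hi : i < n) :
    σ i ∈ Icc a b :=
  ⟨(h.point_mem hi.le).1.trans (h.le_tag i hi), (h.tag_le i hi).trans (h.point_mem hi).2⟩

/-- The filter of tagged partitions `(n, τ, σ)` of `[a, b]` as the mesh tends to `0`: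
Riemann–Stieltjes integrals are the limits of `rsSum` along it. -/
def taggedPartitions (a b : ℝ) : Filter (ℕ × (ℕ → ℝ) × (ℕ → ℝ)) :=
  ⨅ δ > (0 : ℝ), 𝓟 {p | IsTaggedPartition a b δ p.1 p.2.1 p.2.2}

theorem taggedPartitions_hasBasis (a b : ℝ) :
    (taggedPartitions a b).HasBasis (fun δ : ℝ => 0 < δ)
      fun δ => {p | IsTaggedPartition a b δ p.1 p.2.1 p.2.2} := by
  refine hasBasis_biInf_principal' (fun δ hδ δ' hδ' => ?_) ⟨1, one_pos⟩
  exact ⟨min δ δ', lt_min hδ hδ', fun _ hp => hp.mono (min_le_left _ _),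
    fun _ hp => hp.mono (min_le_right _ _)⟩

theorem taggedPartitions_neBot (hab : a ≤ b) : (taggedPartitions a b).NeBot := by
  refine (taggedPartitions_hasBasis a b).neBot_iff.2 fun hδ => ?_
  obtain ⟨n, τ, σ, h⟩ := exists_isTaggedPartition hab hδ
  exact ⟨(n, τ, σ), h⟩

theorem eventually_isTaggedPartition (a b : ℝ) (hδ : 0 < δ) :
    ∀ᶠ p in taggedPartitions a b, IsTaggedPartition a b δ p.1 p.2.1 p.2.2 :=
  (taggedPartitions_hasBasis a b).mem_of_mem hδ

theorem hasRSIntegral_iff_tendsto {f : ℝ → ℂ} {g : ℝ → ℝ} {z : ℂ} :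
    HasRSIntegral f g a b z ↔
      Tendsto (fun p => rsSum f g p.1 p.2.1 p.2.2) (taggedPartitions a b) (𝓝 z) := by
  simp only [(taggedPartitions_hasBasis a b).tendsto_iff Metric.nhds_basis_ball, HasRSIntegral,
    Prod.forall, mem_ofPred_eq, Metric.mem_ball, dist_eq_norm, gt_iff_lt]

end TaggedPartitions

section RiemannStieltjes

variable {f f' : ℝ → ℂ} {g g' : ℝ → ℝ} {a b : ℝ} {z z' : ℂ}

theorem HasRSIntegral.congr (hf : EqOn f f' (Icc a b)) (hg : EqOn g g' (Icc a b))
    (h : HasRSIntegral f g a b z) : HasRSIntegral f' g' a b z := by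
  rw [hasRSIntegral_iff_tendsto] at h ⊢
  refine h.congr' ((eventually_isTaggedPartition a b one_pos).mono fun p hp => ?_)
  refine Finset.sum_congr rfl fun i hi => ?_
  rw [Finset.mem_range] at hi
  rw [hf (hp.tag_mem hi), hg (hp.point_mem hi.le), hg (hp.point_mem hi)]

theorem HasRSIntegral.add (h : HasRSIntegral f g a b z) (h' : HasRSIntegral f' g a b z') :
    HasRSIntegral (fun t => f t + f' t) g a b (z + z') := by
  rw [hasRSIntegral_iff_tendsto] at h h' ⊢
  simpa only [rsSum, add_mul, Finset.sum_add_distrib] using h.add h'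

theorem HasRSIntegral.const_mul (c : ℂ) (h : HasRSIntegral f g a b z) :
    HasRSIntegral (fun t => c * f t) g a b (c * z) := by
  rw [hasRSIntegral_iff_tendsto] at h ⊢
  simpa only [rsSum, Finset.mul_sum, mul_assoc] using Tendsto.const_mul c h

theorem RSIntegrable.hasRSIntegral (hab : a ≤ b) (h : RSIntegrable f g a b) :
    HasRSIntegral f g a b (rsIntegral f g a b) := by
  obtain ⟨z, hz⟩ := h
  rwa [hz.rsIntegral_eq hab]

theorem rsIntegrable_of_forall_approx (hab : a ≤ b)
    (h : ∀ ε > 0, ∃ f', RSIntegrable f' g a b ∧ ∀ᶠ p in taggedPartitions a b,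
      ‖rsSum f g p.1 p.2.1 p.2.2 - rsSum f' g p.1 p.2.1 p.2.2‖ ≤ ε) :
    RSIntegrable f g a b := by
  have := taggedPartitions_neBot hab
  simp only [RSIntegrable, hasRSIntegral_iff_tendsto]
  refine cauchy_map_iff_exists_tendsto.1 (Metric.cauchy_iff.2 ⟨inferInstance, fun ε hε => ?_⟩)
  obtain ⟨f', ⟨z, hz⟩, hf'⟩ := h (ε / 4) (by positivity)
  have hz := Metric.tendsto_nhds.1 (hasRSIntegral_iff_tendsto.1 hz) (ε / 4) (by positivity)
  have hfz : ∀ᶠ p in taggedPartitions a b, dist (rsSum f g p.1 p.2.1 p.2.2) z < ε / 2 := by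
    filter_upwards [hf', hz] with p hp hp'
    rw [← dist_eq_norm] at hp
    linarith [dist_triangle (rsSum f g p.1 p.2.1 p.2.2) (rsSum f' g p.1 p.2.1 p.2.2) z]
  refine ⟨Metric.ball z (ε / 2), hfz, fun x hx y hy => ?_⟩
  linarith [dist_triangle_right x y z, Metric.mem_ball.1 hx, Metric.mem_ball.1 hy]

end RiemannStieltjes

section IntegrationByParts

variable {f h : ℝ → ℂ} {g : ℝ → ℝ}

theorem norm_integral_sub_const_mul_le {u v c ε : ℝ} (huv : u ≤ v)
    (hh : IntervalIntegrable h volume u v) (hc : ∀ s ∈ Icc u v, |g s - c| ≤ ε) :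
    ‖∫ s in u..v, ((g s - c : ℝ) : ℂ) * h s‖ ≤ ε * ∫ s in u..v, ‖h s‖ := by
  rw [← intervalIntegral.integral_const_mul]
  refine intervalIntegral.norm_integral_le_of_norm_le huv
    (Eventually.of_forall fun s hs => ?_) (hh.norm.const_mul ε)
  rw [norm_mul, Complex.norm_real]
  exact mul_le_mul_of_nonneg_right (hc s (Ioc_subset_Icc_self hs)) (norm_nonneg _)

theorem norm_mul_sub_sub_integral_le {u σ v ε : ℝ} (hσ : σ ∈ Icc u v)
    (hg : ContinuousOn g (Icc u v)) (hh : IntervalIntegrable h volume u v)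
    (hfu : f σ - f u = ∫ s in u..σ, h s) (hfv : f v - f σ = ∫ s in σ..v, h s)
    (hosc : ∀ s ∈ Icc u v, ∀ t ∈ Icc u v, |g s - g t| ≤ ε) :
    ‖f σ * ((g v - g u : ℝ) : ℂ) - (f v * g v - f u * g u - ∫ s in u..v, (g s : ℂ) * h s)‖
      ≤ ε * ∫ s in u..v, ‖h s‖ := by
  have huv : u ≤ v := hσ.1.trans hσ.2
  have hh₁ : IntervalIntegrable h volume u σ :=
    hh.mono_set (by rw [uIcc_of_le hσ.1, uIcc_of_le huv]; exact Icc_subset_Icc_right hσ.2)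
  have hh₂ : IntervalIntegrable h volume σ v :=
    hh.mono_set (by rw [uIcc_of_le hσ.2, uIcc_of_le huv]; exact Icc_subset_Icc_left hσ.1)
  have hg' := Complex.continuous_ofReal.comp_continuousOn hg
  have hgh₁ : IntervalIntegrable (fun s => (g s : ℂ) * h s) volume u σ :=
    hh₁.continuousOn_mul (hg'.mono (by rw [uIcc_of_le hσ.1]; exact Icc_subset_Icc_right hσ.2))
  have hgh₂ : IntervalIntegrable (fun s => (g s : ℂ) * h s) volume σ v :=
    hh₂.continuousOn_mul (hg'.mono (by rw [uIcc_of_le hσ.2]; exact Icc_subset_Icc_left hσ.1))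
  have key : f σ * ((g v - g u : ℝ) : ℂ) - (f v * g v - f u * g u - ∫ s in u..v, (g s : ℂ) * h s)
      = (∫ s in u..σ, ((g s - g u : ℝ) : ℂ) * h s)
        + ∫ s in σ..v, ((g s - g v : ℝ) : ℂ) * h s := by
    simp only [Complex.ofReal_sub, sub_mul]
    rw [← intervalIntegral.integral_add_adjacent_intervals hgh₁ hgh₂,
      intervalIntegral.integral_sub hgh₁ (hh₁.const_mul _),
      intervalIntegral.integral_sub hgh₂ (hh₂.const_mul _),
      intervalIntegral.integral_const_mul, intervalIntegral.integral_const_mul, ← hfu, ← hfv]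
    ring
  rw [key, ← intervalIntegral.integral_add_adjacent_intervals hh₁.norm hh₂.norm, mul_add]
  exact (norm_add_le _ _).trans (add_le_add
    (norm_integral_sub_const_mul_le hσ.1 hh₁ fun s hs =>
      hosc s ⟨hs.1, hs.2.trans hσ.2⟩ u (left_mem_Icc.2 huv))
    (norm_integral_sub_const_mul_le hσ.2 hh₂ fun s hs =>
      hosc s ⟨hσ.1.trans hs.1, hs.2⟩ v (right_mem_Icc.2 huv)))

theorem IsTaggedPartition.sum_integral_eq {E : Type*} [NormedAddCommGroup E] [NormedSpace ℝ E]
    {k : ℝ → E} {a b δ : ℝ} {n : ℕ} {τ σ : ℕ → ℝ} (hp : IsTaggedPartition a b δ n τ σ)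
    (hk : IntervalIntegrable k volume a b) :
    ∑ i ∈ Finset.range n, ∫ s in τ i..τ (i + 1), k s = ∫ s in a..b, k s := by
  rw [intervalIntegral.sum_integral_adjacent_intervals, hp.left, hp.right]
  exact fun i hi => hk.mono_set (ordConnected_uIcc.uIcc_subset
    (Icc_subset_uIcc (hp.point_mem hi.le)) (Icc_subset_uIcc (hp.point_mem hi)))

theorem IsTaggedPartition.norm_rsSum_sub_le {a b δ ε : ℝ} {n : ℕ} {τ σ : ℕ → ℝ}
    (hp : IsTaggedPartition a b δ n τ σ) (hab : a ≤ b) (hg : ContinuousOn g (Icc a b))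
    (hh : IntervalIntegrable h volume a b)
    (hf : ∀ s ∈ Icc a b, ∀ t ∈ Icc a b, f t - f s = ∫ u in s..t, h u)
    (hosc : ∀ s ∈ Icc a b, ∀ t ∈ Icc a b, |s - t| < δ → |g s - g t| ≤ ε) :
    ‖rsSum f g n τ σ - (f b * g b - f a * g a - ∫ s in a..b, (g s : ℂ) * h s)‖
      ≤ ε * ∫ s in a..b, ‖h s‖ := by
  have hgh : IntervalIntegrable (fun s => (g s : ℂ) * h s) volume a b :=
    hh.continuousOn_mul (by
      rw [uIcc_of_le hab]; exact Complex.continuous_ofReal.comp_continuousOn hg)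
  have htele : f b * g b - f a * g a =
      ∑ i ∈ Finset.range n, (f (τ (i + 1)) * g (τ (i + 1)) - f (τ i) * g (τ i)) := by
    rw [Finset.sum_range_sub (fun i => f (τ i) * (g (τ i) : ℂ)), hp.left, hp.right]
  rw [htele, ← hp.sum_integral_eq hgh, ← hp.sum_integral_eq hh.norm, ← Finset.sum_sub_distrib,
    rsSum, ← Finset.sum_sub_distrib, Finset.mul_sum]
  refine norm_sum_le_of_le _ fun i hi => ?_
  rw [Finset.mem_range] at hi
  have hu := hp.point_mem hi.le
  have hv := hp.point_mem hi
  have huv : Icc (τ i) (τ (i + 1)) ⊆ Icc a b := Icc_subset_Icc hu.1 hv.2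
  refine norm_mul_sub_sub_integral_le ⟨hp.le_tag i hi, hp.tag_le i hi⟩ (hg.mono huv)
    (hh.mono_set (ordConnected_uIcc.uIcc_subset (Icc_subset_uIcc hu) (Icc_subset_uIcc hv)))
    (hf _ hu _ (hp.tag_mem hi)) (hf _ (hp.tag_mem hi) _ hv)
    fun s hs t ht => hosc s (huv hs) t (huv ht) ?_
  rw [abs_lt]
  constructor <;> linarith [hs.1, hs.2, ht.1, ht.2, hp.mesh i hi]

theorem hasRSIntegral_of_sub_eq_integral {a b : ℝ} (hab : a ≤ b) (hg : ContinuousOn g (Icc a b))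
    (hh : IntervalIntegrable h volume a b)
    (hf : ∀ s ∈ Icc a b, ∀ t ∈ Icc a b, f t - f s = ∫ u in s..t, h u) :
    HasRSIntegral f g a b (f b * g b - f a * g a - ∫ s in a..b, (g s : ℂ) * h s) := by
  intro ε hε
  have hI : 0 ≤ ∫ s in a..b, ‖h s‖ :=
    intervalIntegral.integral_nonneg hab fun _ _ => norm_nonneg _
  obtain ⟨δ, hδ, hosc⟩ := Metric.uniformContinuousOn_iff_le.1
    (isCompact_Icc.uniformContinuousOn_of_continuous hg) (ε / ((∫ s in a..b, ‖h s‖) + 1))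
    (by positivity)
  refine ⟨δ, hδ, fun n τ σ hp => (hp.norm_rsSum_sub_le hab hg hh hf
    fun s hs t ht hst => hosc s hs t ht hst.le).trans_lt ?_⟩
  rw [div_mul_eq_mul_div, div_lt_iff₀ (by positivity)]
  linarith

theorem hasRSIntegral_primitive {a b : ℝ} (hab : a ≤ b) (hg : ContinuousOn g (Icc a b))
    (hh : IntervalIntegrable h volume a b) :
    HasRSIntegral (fun t => ∫ s in a..t, h s) g a b
      (∫ s in a..b, ((g b - g s : ℝ) : ℂ) * h s) := by
  have hsub : ∀ t ∈ Icc a b, IntervalIntegrable h volume a t := fun t ht =>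
    hh.mono_set (ordConnected_uIcc.uIcc_subset left_mem_uIcc (Icc_subset_uIcc ht))
  have hgh : IntervalIntegrable (fun s => (g s : ℂ) * h s) volume a b :=
    hh.continuousOn_mul (by
      rw [uIcc_of_le hab]; exact Complex.continuous_ofReal.comp_continuousOn hg)
  convert hasRSIntegral_of_sub_eq_integral hab hg hh fun s hs t ht =>
    intervalIntegral.integral_interval_sub_left (hsub t ht) (hsub s hs) using 1
  simp only [Complex.ofReal_sub, sub_mul]
  rw [intervalIntegral.integral_sub (hh.const_mul _) hgh, intervalIntegral.integral_const_mul,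
    intervalIntegral.integral_same]
  ring

end IntegrationByParts

section YoungLoeve

/-- The increasing enumeration of `ℕ \ {m}`. Composing the points and the tags of a partition with
`skip m` deletes the point and the tag of index `m`. -/
def skip (m j : ℕ) : ℕ := if j < m then j else j + 1

theorem skip_of_lt {m j : ℕ} (h : j < m) : skip m j = j := if_pos h

theorem skip_of_le {m j : ℕ} (h : m ≤ j) : skip m j = j + 1 := if_neg h.not_gt

theorem rsSum_succ (f : ℝ → ℂ) (g : ℝ → ℝ) (n : ℕ) (τ σ : ℕ → ℝ) :
    rsSum f g (n + 1) τ σ =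
      rsSum f g n τ σ + f (σ n) * ((g (τ (n + 1)) - g (τ n) : ℝ) : ℂ) :=
  Finset.sum_range_succ _ _

theorem rsSum_comp_skip_of_lt (f : ℝ → ℂ) (g : ℝ → ℝ) {m n : ℕ} (h : n < m) (τ σ : ℕ → ℝ) :
    rsSum f g n (τ ∘ skip m) (σ ∘ skip m) = rsSum f g n τ σ := by
  refine Finset.sum_congr rfl fun i hi => ?_
  rw [Finset.mem_range] at hi
  simp only [Function.comp_apply, skip_of_lt (show i < m by omega),
    skip_of_lt (show i + 1 < m by omega)]

theorem rsSum_sub_rsSum_comp_skip (f : ℝ → ℂ) (g : ℝ → ℝ) {m n : ℕ} (hmn : m + 1 ≤ n)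
    (τ σ : ℕ → ℝ) :
    rsSum f g (n + 1) τ σ - rsSum f g n (τ ∘ skip (m + 1)) (σ ∘ skip (m + 1))
      = (f (σ (m + 1)) - f (σ m)) * ((g (τ (m + 2)) - g (τ (m + 1)) : ℝ) : ℂ) := by
  induction n, hmn using Nat.le_induction with
  | base =>
    simp only [rsSum_succ, rsSum_comp_skip_of_lt f g m.lt_succ_self, Function.comp_apply,
      skip_of_lt m.lt_succ_self, skip_of_le le_rfl]
    push_cast
    ring
  | succ n hmn ih =>
    rw [← ih, rsSum_succ _ _ (n + 1), rsSum_succ _ _ n (τ ∘ _)]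
    simp only [Function.comp_apply, skip_of_le hmn, skip_of_le (hmn.trans n.le_succ)]
    ring

variable {a b δ : ℝ} {n : ℕ} {τ σ : ℕ → ℝ}

theorem IsTaggedPartition.comp_skip (h : IsTaggedPartition a b δ (n + 1) τ σ) {m : ℕ}
    (hm : m < n) :
    IsTaggedPartition a b (2 * δ) n (τ ∘ skip (m + 1)) (σ ∘ skip (m + 1)) where
  left := h.left
  right := by simp only [Function.comp_apply, skip_of_le (Nat.succ_le_of_lt hm), h.right]
  le_tag i hi := h.le_tag _ (by unfold skip; split_ifs <;> omega)
  tag_le i hi := by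
    rcases lt_trichotomy i m with him | rfl | him
    · simpa only [Function.comp_apply, skip_of_lt (show i < m + 1 by omega),
        skip_of_lt (show i + 1 < m + 1 by omega)] using h.tag_le i (by omega)
    · simpa only [Function.comp_apply, skip_of_lt i.lt_succ_self, skip_of_le le_rfl]
        using (h.tag_le i (by omega)).trans (h.le_succ (by omega))
    · simpa only [Function.comp_apply, skip_of_le (show m + 1 ≤ i by omega),
        skip_of_le (show m + 1 ≤ i + 1 by omega)] using h.tag_le (i + 1) (by omega)
  mesh i hi := by
    have hi₀ := h.mesh i (by omega)
    have hδ : 0 < δ := (sub_nonneg.2 (h.le_succ (by omega))).trans_lt hi₀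
    have hi₁ := h.mesh (i + 1) (by omega)
    rcases lt_trichotomy i m with him | rfl | him
    · simp only [Function.comp_apply, skip_of_lt (show i < m + 1 by omega),
        skip_of_lt (show i + 1 < m + 1 by omega)]
      linarith
    · simp only [Function.comp_apply, skip_of_lt i.lt_succ_self, skip_of_le le_rfl]
      linarith
    · simp only [Function.comp_apply, skip_of_le (show m + 1 ≤ i by omega),
        skip_of_le (show m + 1 ≤ i + 1 by omega)]
      linarith

theorem IsTaggedPartition.exists_two_step_le (h : IsTaggedPartition a b δ (n + 2) τ σ) :
    ∃ m ≤ n, τ (m + 2) - τ m ≤ 2 * (b - a) / (n + 1 : ℕ) := by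
  by_contra! hlt
  have hsum : ∑ i ∈ Finset.range (n + 1), (2 * (b - a) / (n + 1 : ℕ))
      < ∑ i ∈ Finset.range (n + 1), ((τ (i + 1 + 1) - τ (i + 1)) + (τ (i + 1) - τ i)) := by
    refine Finset.sum_lt_sum_of_nonempty (by simp) fun i hi => ?_
    have := hlt i (by rw [Finset.mem_range] at hi; omega)
    linarith
  rw [Finset.sum_add_distrib, Finset.sum_range_sub (fun i => τ (i + 1)), Finset.sum_range_sub,
    Finset.sum_const, Finset.card_range, nsmul_eq_mul, mul_div_cancel₀ _ (by positivity),
    zero_add, h.left, h.right] at hsum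
  linarith [(h.point_mem (i := 1) (by omega)).1, (h.point_mem (i := n + 1) (by omega)).2]

variable {f : ℝ → ℂ} {g : ℝ → ℝ} {A C α β : ℝ≥0}

theorem norm_sub_mul_sub_le {s t : Set ℝ} (hf : HolderOnWith A α f s) (hg : HolderOnWith C β g t)
    {D x y u v : ℝ} (hx : x ∈ s) (hy : y ∈ s) (hu : u ∈ t) (hv : v ∈ t)
    (hxy : dist x y ≤ D) (huv : dist u v ≤ D) :
    ‖(f x - f y) * ((g u - g v : ℝ) : ℂ)‖ ≤ A * C * D ^ (α + β : ℝ) := by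
  have hD : 0 ≤ D := dist_nonneg.trans hxy
  rw [norm_mul, Complex.norm_real, ← dist_eq_norm, ← dist_eq_norm,
    Real.rpow_add_of_nonneg hD α.coe_nonneg β.coe_nonneg, mul_mul_mul_comm]
  gcongr
  · exact (hf.dist_le hx hy).trans (by gcongr)
  · exact (hg.dist_le hu hv).trans (by gcongr)

theorem IsTaggedPartition.norm_rsSum_sub_comp_skip_le {m : ℕ} (hm : m ≤ n)
    (h : IsTaggedPartition a b δ (n + 2) τ σ)
    (hf : HolderOnWith A α f (Icc a b)) (hg : HolderOnWith C β g (Icc a b)) :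
    ‖rsSum f g (n + 2) τ σ - rsSum f g (n + 1) (τ ∘ skip (m + 1)) (σ ∘ skip (m + 1))‖
      ≤ A * C * (τ (m + 2) - τ m) ^ (α + β : ℝ) := by
  have h₁ := h.le_tag m (by omega)
  have h₂ := h.tag_le m (by omega)
  have h₃ := h.le_tag (m + 1) (by omega)
  have h₄ := h.tag_le (m + 1) (by omega)
  rw [rsSum_sub_rsSum_comp_skip f g (by omega)]
  refine norm_sub_mul_sub_le hf hg (h.tag_mem (by omega)) (h.tag_mem (by omega))
    (h.point_mem (by omega)) (h.point_mem (by omega)) ?_ ?_ <;>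
  · rw [Real.dist_eq, abs_of_nonneg (by linarith)]
    linarith

theorem norm_rsSum_sub_le (hf : HolderOnWith A α f (Icc a b)) (hg : HolderOnWith C β g (Icc a b))
    (h : IsTaggedPartition a b δ (n + 1) τ σ) :
    ‖rsSum f g (n + 1) τ σ - f (σ 0) * ((g b - g a : ℝ) : ℂ)‖
      ≤ A * C * ((2 * (b - a)) ^ (α + β : ℝ) *
        ∑ k ∈ Finset.range n, 1 / ((k + 1 : ℕ) : ℝ) ^ (α + β : ℝ)) := by
  induction n generalizing δ τ σ with
  | zero => simp [rsSum, h.left, h.right.symm]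
  | succ n ih =>
    obtain ⟨m, hm, hmle⟩ := h.exists_two_step_le
    have hba : 0 ≤ 2 * (b - a) := by
      linarith [(h.point_mem (Nat.zero_le _)).1, (h.point_mem (Nat.zero_le _)).2]
    have hstep := calc
      ‖rsSum f g (n + 2) τ σ - rsSum f g (n + 1) (τ ∘ skip (m + 1)) (σ ∘ skip (m + 1))‖
          ≤ A * C * (τ (m + 2) - τ m) ^ (α + β : ℝ) :=
            h.norm_rsSum_sub_comp_skip_le hm hf hg
      _ ≤ A * C * (2 * (b - a) / (n + 1 : ℕ)) ^ (α + β : ℝ) := by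
            gcongr
            linarith [h.le_succ (i := m) (by omega), h.le_succ (i := m + 1) (by omega)]
      _ = A * C * ((2 * (b - a)) ^ (α + β : ℝ) * (1 / ((n + 1 : ℕ) : ℝ) ^ (α + β : ℝ))) := by
            rw [Real.div_rpow hba (by positivity), div_eq_mul_one_div]
    have hih := ih (h.comp_skip (Nat.lt_succ_of_le hm))
    rw [Function.comp_apply, skip_of_lt m.succ_pos] at hih
    rw [Finset.sum_range_succ, mul_add, mul_add, add_comm (A * C * _ : ℝ)]
    exact (norm_sub_le_norm_sub_add_norm_sub _ _ _).trans (add_le_add hstep hih)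

theorem norm_rsSum_le {F : ℝ} (hαβ : 1 < α + β) (hab : a ≤ b)
    (hf : HolderOnWith A α f (Icc a b)) (hg : HolderOnWith C β g (Icc a b))
    (hF : ∀ s ∈ Icc a b, ‖f s‖ ≤ F) (h : IsTaggedPartition a b δ n τ σ) :
    ‖rsSum f g n τ σ‖ ≤ F * |g b - g a| + A * C *
      ((2 * (b - a)) ^ (α + β : ℝ) * ∑' k : ℕ, 1 / ((k + 1 : ℕ) : ℝ) ^ (α + β : ℝ)) := by
  have : 0 ≤ 2 * (b - a) := by linarith
  have hF₀ : 0 ≤ F := (norm_nonneg _).trans (hF a (left_mem_Icc.2 hab))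
  cases n with
  | zero =>
    have : 0 ≤ ∑' k : ℕ, 1 / ((k + 1 : ℕ) : ℝ) ^ (α + β : ℝ) := tsum_nonneg fun k => by positivity
    simp only [rsSum, Finset.range_zero, Finset.sum_empty, norm_zero]
    positivity
  | succ n =>
    have hsummable : Summable fun k : ℕ => 1 / ((k + 1 : ℕ) : ℝ) ^ (α + β : ℝ) :=
      (Real.summable_one_div_nat_rpow.2 (by exact_mod_cast hαβ)).comp_injective
        (add_left_injective 1)
    have hfirst : ‖f (σ 0) * ((g b - g a : ℝ) : ℂ)‖ ≤ F * |g b - g a| := by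
      rw [norm_mul, Complex.norm_real, Real.norm_eq_abs]
      gcongr
      exact hF _ (h.tag_mem n.succ_pos)
    have hsum := hsummable.sum_le_tsum (Finset.range n) fun k _ => by positivity
    calc ‖rsSum f g (n + 1) τ σ‖
        ≤ ‖f (σ 0) * ((g b - g a : ℝ) : ℂ)‖
          + ‖rsSum f g (n + 1) τ σ - f (σ 0) * ((g b - g a : ℝ) : ℂ)‖ :=
          norm_le_norm_add_norm_sub' _ _
      _ ≤ _ := add_le_add hfirst ((norm_rsSum_sub_le hf hg h).trans (by gcongr))

end YoungLoeve

theorem holderOnWith_of_dist_le {X Y : Type*} [PseudoMetricSpace X] [PseudoMetricSpace Y]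
    {C r : ℝ≥0} {f : X → Y} {s : Set X}
    (h : ∀ x ∈ s, ∀ y ∈ s, dist (f x) (f y) ≤ C * dist x y ^ (r : ℝ)) : HolderOnWith C r f s := by
  intro x hx y hy
  rw [edist_dist, edist_dist, ← ENNReal.ofReal_coe_nnreal,
    ENNReal.ofReal_rpow_of_nonneg dist_nonneg r.coe_nonneg, ← ENNReal.ofReal_mul C.coe_nonneg]
  exact ENNReal.ofReal_le_ofReal (h x hx y hy)

theorem holderWith_of_dist_le {X Y : Type*} [PseudoMetricSpace X] [PseudoMetricSpace Y]
    {C r : ℝ≥0} {f : X → Y} (h : ∀ x y, dist (f x) (f y) ≤ C * dist x y ^ (r : ℝ)) :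
    HolderWith C r f :=
  holderOnWith_univ.1 (holderOnWith_of_dist_le fun x _ y _ => h x y)

section SteklovAverage

variable {E : Type*} [NormedAddCommGroup E] [NormedSpace ℝ E]

/-- The Steklov average of `f`, its mean over `[t, t + h]`. The integral runs over `[0, 1]` so that
no division by `h` occurs. -/
noncomputable def steklovAverage (f : ℝ → E) (h t : ℝ) : E := ∫ u in (0 : ℝ)..1, f (t + h * u)

variable {f : ℝ → E} {A α h : ℝ≥0}

theorem holderWith_steklovAverage (hα : 0 < α) (hf : HolderWith A α f) (h : ℝ) :
    HolderWith A α (steklovAverage f h) := by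
  refine holderWith_of_dist_le fun t s => ?_
  have hcont := hf.continuous hα
  rw [dist_eq_norm, steklovAverage, steklovAverage, ← intervalIntegral.integral_sub
    (Continuous.intervalIntegrable (by fun_prop) _ _)
    (Continuous.intervalIntegrable (by fun_prop) _ _)]
  refine (intervalIntegral.norm_integral_le_of_norm_le_const fun u _ => ?_).trans_eq
    (by rw [sub_zero, abs_one, mul_one])
  simpa only [dist_eq_norm, add_sub_add_right_eq_sub] using hf.dist_le (t + h * u) (s + h * u)

theorem norm_sub_steklovAverage_le [CompleteSpace E] (hα : 0 < α) (hf : HolderWith A α f) (t : ℝ) :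
    ‖f t - steklovAverage f h t‖ ≤ (A * h ^ (α : ℝ) : ℝ≥0) := by
  have hcont := hf.continuous hα
  have hsub : f t - steklovAverage f h t = ∫ u in (0 : ℝ)..1, (f t - f (t + h * u)) := by
    rw [intervalIntegral.integral_sub (Continuous.intervalIntegrable (by fun_prop) _ _)
      (Continuous.intervalIntegrable (by fun_prop) _ _), intervalIntegral.integral_const, sub_zero,
      one_smul, steklovAverage]
  rw [hsub]
  refine (intervalIntegral.norm_integral_le_of_norm_le_const fun u hu => ?_).trans_eq
    (by rw [sub_zero, abs_one, mul_one])
  rw [uIoc_of_le zero_le_one] at hu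
  rw [← dist_eq_norm]
  refine hf.dist_le_of_le ?_
  rw [Real.dist_eq, sub_add_cancel_left, abs_neg, abs_of_nonneg (mul_nonneg h.coe_nonneg hu.1.le)]
  exact mul_le_of_le_one_right h.coe_nonneg hu.2

theorem holderWith_sub_steklovAverage [CompleteSpace E] (hα : 0 < α) (hf : HolderWith A α f)
    {θ₁ θ₂ : ℝ≥0} (hθ : θ₁ + θ₂ = 1) :
    HolderWith ((A + A) ^ (θ₁ : ℝ) * (A * h ^ (α : ℝ) + A * h ^ (α : ℝ)) ^ (θ₂ : ℝ)) (θ₁ * α)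
      (fun t => f t - steklovAverage f h t) := by
  have hholder : HolderWith (A + A) α (fun t => f t - steklovAverage f h t) :=
    holderWith_of_dist_le fun t s => (dist_sub_sub_le _ _ _ _).trans (by
      rw [NNReal.coe_add, add_mul]
      exact add_le_add (hf.dist_le t s) ((holderWith_steklovAverage hα hf h).dist_le t s))
  have hbdd : HolderWith (A * h ^ (α : ℝ) + A * h ^ (α : ℝ)) 0
      (fun t => f t - steklovAverage f h t) :=
    holderWith_of_dist_le fun t s => (dist_le_norm_add_norm _ _).trans (by
      rw [NNReal.coe_zero, Real.rpow_zero, mul_one, NNReal.coe_add]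
      exact add_le_add (norm_sub_steklovAverage_le hα hf t) (norm_sub_steklovAverage_le hα hf s))
  simpa only [zero_mul, add_zero, mul_comm α] using hholder.interpolate hbdd hθ

theorem steklovAverage_sub_eq_integral (hf : Continuous f) {h : ℝ} (hh : h ≠ 0) (s t : ℝ) :
    steklovAverage f h t - steklovAverage f h s = ∫ u in s..t, h⁻¹ • (f (u + h) - f u) := by
  have haverage : ∀ t, steklovAverage f h t = h⁻¹ • ∫ u in t..(t + h), f u := fun t => by
    rw [steklovAverage, intervalIntegral.integral_comp_add_mul _ hh, mul_zero, add_zero, mul_one]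
  have hint : ∀ a b : ℝ, IntervalIntegrable f volume a b := fun a b => hf.intervalIntegrable a b
  rw [intervalIntegral.integral_smul, intervalIntegral.integral_sub
    (Continuous.intervalIntegrable (by fun_prop) _ _) (hint _ _),
    intervalIntegral.integral_comp_add_right, haverage, haverage, ← smul_sub,
    intervalIntegral.integral_interval_sub_interval_comm' (hint _ _) (hint _ _) (hint _ _)]

end SteklovAverage

section Young

variable {f : ℝ → ℂ} {g : ℝ → ℝ} {a b : ℝ} {A C α β : ℝ≥0}

theorem rsIntegrable_steklovAverage (hab : a ≤ b) (hf : Continuous f)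
    (hg : ContinuousOn g (Icc a b)) {h : ℝ} (hh : h ≠ 0) :
    RSIntegrable (steklovAverage f h) g a b :=
  ⟨_, hasRSIntegral_of_sub_eq_integral hab hg (Continuous.intervalIntegrable (by fun_prop) _ _)
    fun s _ t _ => steklovAverage_sub_eq_integral hf hh s t⟩

theorem exists_mul_add_gt_one (hα : 0 < α) (hαβ : 1 < α + β) :
    ∃ θ₁ θ₂ : ℝ≥0, θ₁ + θ₂ = 1 ∧ 0 < θ₂ ∧ 1 < θ₁ * α + β := by
  have hβα : 1 - β < α := by
    rw [← NNReal.coe_lt_coe, NNReal.coe_sub_def, max_lt_iff]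
    exact ⟨sub_lt_iff_lt_add.2 (by exact_mod_cast hαβ), hα⟩
  obtain ⟨θ, hθ, hθ₁⟩ : ∃ θ, (1 - β) / α < θ ∧ θ < 1 := exists_between ((div_lt_one hα).2 hβα)
  exact ⟨θ, 1 - θ, add_tsub_cancel_of_le hθ₁.le, tsub_pos_of_lt hθ₁,
    lt_add_of_tsub_lt_right ((div_lt_iff₀ hα).1 hθ)⟩

theorem rsIntegrable_of_holderWith (hab : a ≤ b) (hα : 0 < α) (hβ : 0 < β) (hαβ : 1 < α + β)
    (hf : HolderWith A α f) (hg : HolderOnWith C β g (Icc a b)) : RSIntegrable f g a b := by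
  obtain ⟨θ₁, θ₂, hθ, hθ₂, hθαβ⟩ := exists_mul_add_gt_one hα hαβ
  refine rsIntegrable_of_forall_approx hab fun ε hε => ?_
  set S := (2 * (b - a)) ^ ((θ₁ * α : ℝ≥0) + β : ℝ) *
    ∑' k : ℕ, 1 / ((k + 1 : ℕ) : ℝ) ^ ((θ₁ * α : ℝ≥0) + β : ℝ)
  let bound : ℝ≥0 → ℝ := fun h => (A * h ^ (α : ℝ) : ℝ≥0) * |g b - g a| +
    ((A + A) ^ (θ₁ : ℝ) * (A * h ^ (α : ℝ) + A * h ^ (α : ℝ)) ^ (θ₂ : ℝ) : ℝ≥0) * C * S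
  have hbound : Tendsto bound (𝓝[>] 0) (𝓝 0) := by
    have : Continuous bound := by
      have := NNReal.continuous_rpow_const α.coe_nonneg
      have := NNReal.continuous_rpow_const θ₂.coe_nonneg
      fun_prop
    convert this.continuousWithinAt.tendsto using 2
    simp [bound, Real.zero_rpow (NNReal.coe_ne_zero.2 hα.ne'),
      Real.zero_rpow (NNReal.coe_ne_zero.2 hθ₂.ne')]
  obtain ⟨h, hhε, hh⟩ := ((hbound.eventually (gt_mem_nhds hε)).and self_mem_nhdsWithin).exists
  refine ⟨steklovAverage f h, rsIntegrable_steklovAverage hab (hf.continuous hα)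
    (hg.continuousOn hβ) (NNReal.coe_ne_zero.2 (ne_of_gt hh)), ?_⟩
  filter_upwards [eventually_isTaggedPartition a b one_pos] with p hp
  have hsub : rsSum f g p.1 p.2.1 p.2.2 - rsSum (steklovAverage f h) g p.1 p.2.1 p.2.2
      = rsSum (fun t => f t - steklovAverage f h t) g p.1 p.2.1 p.2.2 := by
    simp only [rsSum, sub_mul, Finset.sum_sub_distrib]
  rw [hsub]
  exact (norm_rsSum_le hθαβ hab ((holderWith_sub_steklovAverage hα hf hθ).holderOnWith _) hg
    (fun t _ => norm_sub_steklovAverage_le hα hf t) hp).trans hhε.le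

theorem rsIntegrable_of_holderOnWith (hab : a ≤ b) (hα : 0 < α) (hβ : 0 < β) (hαβ : 1 < α + β)
    (hf : HolderOnWith A α f (Icc a b)) (hg : HolderOnWith C β g (Icc a b)) :
    RSIntegrable f g a b := by
  have hext : HolderWith A α (IccExtend hab ((Icc a b).domRestrict f)) := by
    simpa [IccExtend] using hf.holderWith.comp (holderWith_one.2 (LipschitzWith.projIcc hab))
  obtain ⟨z, hz⟩ := rsIntegrable_of_holderWith hab hα hβ hαβ hext hg
  exact ⟨z, hz.congr (fun t ht => IccExtend_of_mem hab _ ht) fun _ _ => rfl⟩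

end Young

section DyadicChaining

/-- The largest dyadic number of level `n` not exceeding `s ≥ 0`. -/
noncomputable def dyadicFloor (n : ℕ) (s : ℝ) : ℝ :=
  ⌊s * 2 ^ n⌋₊ / 2 ^ n

theorem floor_mul_two_pow_le {s : ℝ} (hs : s ≤ 1) (n : ℕ) : ⌊s * 2 ^ n⌋₊ ≤ 2 ^ n := by
  refine Nat.floor_le_of_le ?_
  push_cast
  exact mul_le_of_le_one_left (by positivity) hs

theorem div_two_pow_mem_Icc {n k : ℕ} (hk : k ≤ 2 ^ n) : (k / 2 ^ n : ℝ) ∈ Icc (0 : ℝ) 1 := by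
  refine ⟨by positivity, ?_⟩
  rw [div_le_one (by positivity)]
  exact_mod_cast hk

theorem tendsto_dyadicFloor {s : ℝ} (hs : 0 ≤ s) :
    Tendsto (fun n => dyadicFloor n s) atTop (𝓝 s) :=
  (tendsto_nat_floor_mul_div_atTop hs).comp (tendsto_pow_atTop_atTop_of_one_lt one_lt_two)

variable {E : Type*} [PseudoEMetricSpace E] {f : ℝ → E} {c C : ℝ≥0∞} {n : ℕ} {s t : ℝ}

theorem edist_dyadic_le
    (H : ∀ k : ℕ, k < 2 ^ n → edist (f (k / 2 ^ n)) (f ((k + 1 : ℕ) / 2 ^ n)) ≤ c)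
    {j k : ℕ} (hjk : j ≤ k) (hkj : k ≤ j + 1) (hk : k ≤ 2 ^ n) :
    edist (f (j / 2 ^ n)) (f (k / 2 ^ n)) ≤ c := by
  rcases hjk.eq_or_lt with rfl | h
  · simp
  · obtain rfl : k = j + 1 := by lia
    exact H j hk

theorem edist_dyadicFloor_succ_le (hs : s ∈ Icc 0 1)
    (H : ∀ k : ℕ, k < 2 ^ (n + 1) →
      edist (f (k / 2 ^ (n + 1))) (f ((k + 1 : ℕ) / 2 ^ (n + 1))) ≤ c) :
    edist (f (dyadicFloor n s)) (f (dyadicFloor (n + 1) s)) ≤ c := by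
  have h0 : 0 ≤ s * 2 ^ n := mul_nonneg hs.1 (by positivity)
  have hsucc : s * 2 ^ (n + 1) = 2 * (s * 2 ^ n) := by ring
  have hle : 2 * ⌊s * 2 ^ n⌋₊ ≤ ⌊s * 2 ^ (n + 1)⌋₊ := by
    refine Nat.le_floor ?_
    push_cast
    linarith [Nat.floor_le h0]
  have hge : ⌊s * 2 ^ (n + 1)⌋₊ ≤ 2 * ⌊s * 2 ^ n⌋₊ + 1 := by
    refine Nat.lt_succ_iff.1 ((Nat.floor_lt (by linarith)).2 ?_)
    push_cast
    linarith [Nat.lt_floor_add_one (s * 2 ^ n)]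
  have hrefine : dyadicFloor n s = (2 * ⌊s * 2 ^ n⌋₊ : ℕ) / 2 ^ (n + 1) := by
    rw [dyadicFloor, pow_succ]
    push_cast
    field_simp
  rw [hrefine]
  exact edist_dyadic_le H hle hge (floor_mul_two_pow_le hs.2 _)

theorem edist_dyadicFloor_le (hs : 0 ≤ s) (ht : t ≤ 1) (hst : s ≤ t) (hn : t - s ≤ 2⁻¹ ^ n)
    (H : ∀ k : ℕ, k < 2 ^ n → edist (f (k / 2 ^ n)) (f ((k + 1 : ℕ) / 2 ^ n)) ≤ c) :
    edist (f (dyadicFloor n s)) (f (dyadicFloor n t)) ≤ c := by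
  have hpow : (0 : ℝ) < 2 ^ n := by positivity
  refine edist_dyadic_le H (Nat.floor_le_floor (by gcongr)) ?_ (floor_mul_two_pow_le ht n)
  rw [← Nat.floor_add_one (mul_nonneg hs hpow.le)]
  refine Nat.floor_le_floor ?_
  rw [inv_pow, ← one_div, le_div_iff₀ hpow] at hn
  linarith

theorem edist_dyadicFloor_self_le {r : ℝ≥0∞} (hr : r ≤ 1) (hf : ContinuousOn f (Icc 0 1))
    (H : ∀ n k : ℕ, k < 2 ^ n → edist (f (k / 2 ^ n)) (f ((k + 1 : ℕ) / 2 ^ n)) ≤ C * r ^ n)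
    (hs : s ∈ Icc 0 1) (n : ℕ) : edist (f (dyadicFloor n s)) (f s) ≤ C * r ^ n / (1 - r) := by
  have hmem (m : ℕ) : dyadicFloor m s ∈ Icc 0 1 :=
    div_two_pow_mem_Icc (floor_mul_two_pow_le hs.2 m)
  have hlim : Tendsto (fun m => f (dyadicFloor m s)) atTop (𝓝 (f s)) :=
    (hf s hs).tendsto.comp
      (tendsto_nhdsWithin_iff.2 ⟨tendsto_dyadicFloor hs.1, Eventually.of_forall hmem⟩)
  refine edist_le_of_edist_le_geometric_of_tendsto r C (fun m => ?_) hlim n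
  exact (edist_dyadicFloor_succ_le hs (H (m + 1))).trans
    (mul_le_mul_right (pow_le_pow_right_of_le_one' hr m.le_succ) C)

theorem inv_two_rpow_pow_le (hn : 2⁻¹ ^ (n + 1) < t - s) {α : ℝ} (hα : 0 ≤ α) :
    ((2⁻¹ : ℝ≥0∞) ^ α) ^ n ≤ 2 ^ α * edist s t ^ α := by
  have hpow : (2⁻¹ : ℝ≥0∞) ^ n ≤ 2 * edist s t := by
    rw [edist_comm, edist_dist, Real.dist_eq]
    calc (2⁻¹ : ℝ≥0∞) ^ n
      _ = ENNReal.ofReal (2⁻¹ ^ n) := by simp [ENNReal.ofReal_inv_of_pos, ENNReal.inv_pow]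
      _ ≤ ENNReal.ofReal (2 * |t - s|) := by
        rw [pow_succ] at hn
        gcongr
        linarith [le_abs_self (t - s)]
      _ = 2 * ENNReal.ofReal |t - s| := by simp [ENNReal.ofReal_mul]
  rw [← ENNReal.mul_rpow_of_nonneg _ _ hα, ← ENNReal.rpow_natCast, ← ENNReal.rpow_mul, mul_comm α,
    ENNReal.rpow_mul, ENNReal.rpow_natCast]
  gcongr

theorem exists_holderOnWith_of_edist_dyadic_le {α : ℝ≥0} (hα : 0 < α) (hC : C ≠ ∞)
    (hf : ContinuousOn f (Icc 0 1))
    (H : ∀ n k : ℕ, k < 2 ^ n →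
      edist (f (k / 2 ^ n)) (f ((k + 1 : ℕ) / 2 ^ n)) ≤ C * (2⁻¹ ^ (α : ℝ)) ^ n) :
    ∃ K, HolderOnWith K α f (Icc 0 1) := by
  set r : ℝ≥0∞ := 2⁻¹ ^ (α : ℝ)
  have hr1 : r < 1 := ENNReal.rpow_lt_one (by norm_num) (mod_cast hα)
  set K : ℝ≥0∞ := C * (1 + 2 / (1 - r)) * 2 ^ (α : ℝ) with hK
  have hK_top : K ≠ ∞ := by
    have : (1 - r) ≠ 0 := (tsub_pos_of_lt hr1).ne'
    finiteness
  have hlt {s t : ℝ} (hs : s ∈ Icc 0 1) (ht : t ∈ Icc 0 1) (hst : s < t) :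
      edist (f s) (f t) ≤ K * edist s t ^ (α : ℝ) := by
    obtain ⟨n, hlow, hup⟩ := exists_nat_pow_near_of_lt_one (sub_pos.2 hst)
      (by linarith [hs.1, ht.2] : t - s ≤ 1) (by norm_num : (0 : ℝ) < 2⁻¹) (by norm_num)
    calc edist (f s) (f t)
      _ ≤ edist (f s) (f (dyadicFloor n s)) + edist (f (dyadicFloor n s)) (f (dyadicFloor n t))
          + edist (f (dyadicFloor n t)) (f t) := edist_triangle4 ..
      _ ≤ C * r ^ n / (1 - r) + C * r ^ n + C * r ^ n / (1 - r) := by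
        gcongr
        · rw [edist_comm]
          exact edist_dyadicFloor_self_le hr1.le hf H hs n
        · exact edist_dyadicFloor_le hs.1 ht.2 hst.le hup (H n)
        · exact edist_dyadicFloor_self_le hr1.le hf H ht n
      _ = C * (1 + 2 / (1 - r)) * r ^ n := by
        simp only [div_eq_mul_inv]
        ring
      _ ≤ C * (1 + 2 / (1 - r)) * (2 ^ (α : ℝ) * edist s t ^ (α : ℝ)) := by
        gcongr
        exact inv_two_rpow_pow_le hlow α.coe_nonneg
      _ = K * edist s t ^ (α : ℝ) := by rw [hK, mul_assoc _ (2 ^ _)]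
  refine ⟨K.toNNReal, fun s hs t ht => ?_⟩
  rw [ENNReal.coe_toNNReal hK_top]
  rcases lt_trichotomy s t with hst | rfl | hst
  · exact hlt hs ht hst
  · simp
  · rw [edist_comm, edist_comm s]
    exact hlt ht hs hst

end DyadicChaining

section KolmogorovContinuity

variable {Ω : Type*} [MeasurableSpace Ω] {P : Measure Ω} {p q : ℝ}

theorem ae_exists_le_of_tsum_lintegral_ne_top {N : ℕ → ℕ} {Y : ℕ → ℕ → Ω → ℝ≥0∞}
    (hY : ∀ n, ∀ k < N n, AEMeasurable (Y n k) P)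
    (hsum : ∑' n, ∑ k ∈ Finset.range (N n), ∫⁻ ω, Y n k ω ∂P ≠ ∞) :
    ∀ᵐ ω ∂P, ∃ C ≠ ∞, ∀ n, ∀ k < N n, Y n k ω ≤ C := by
  have hmeas (n : ℕ) : AEMeasurable (fun ω => ∑ k ∈ Finset.range (N n), Y n k ω) P :=
    Finset.aemeasurable_fun_sum _ fun k hk => hY n k (Finset.mem_range.1 hk)
  have hint : ∫⁻ ω, ∑' n, ∑ k ∈ Finset.range (N n), Y n k ω ∂P ≠ ∞ := by
    rw [lintegral_tsum hmeas]
    convert! hsum using 3 with n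
    exact lintegral_finsetSum' _ fun k hk => hY n k (Finset.mem_range.1 hk)
  filter_upwards [ae_lt_top' (AEMeasurable.tsum hmeas) hint] with ω hω
  refine ⟨_, hω.ne, fun n k hk => ?_⟩
  exact (Finset.single_le_sum (f := fun k => Y n k ω) (fun _ _ => zero_le)
    (Finset.mem_range.2 hk)).trans
      (ENNReal.le_tsum (f := fun n => ∑ k ∈ Finset.range (N n), Y n k ω) n)

theorem two_rpow_pow_ne_top (s : ℝ) (n : ℕ) : ((2 : ℝ≥0∞) ^ s) ^ n ≠ ∞ :=
  ENNReal.pow_ne_top (ENNReal.rpow_ne_top_of_ne_zero two_ne_zero (by simp))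

theorem sum_lintegral_rpow_le {Y : ℕ → Ω → ℝ≥0∞} {A : ℝ≥0∞} (hp : 0 ≤ p) (α : ℝ) {n : ℕ}
    (hmom : ∀ k < 2 ^ n, ∫⁻ ω, Y k ω ^ p ∂P ≤ A * (2⁻¹ ^ q) ^ n) :
    ∑ k ∈ Finset.range (2 ^ n), ∫⁻ ω, ((2 ^ α) ^ n * Y k ω) ^ p ∂P
      ≤ A * (2 ^ (1 + α * p - q)) ^ n := by
  have hrpow (k : ℕ) (ω : Ω) : ((2 ^ α) ^ n * Y k ω) ^ p = (2 ^ (α * p)) ^ n * Y k ω ^ p := by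
    rw [ENNReal.mul_rpow_of_nonneg _ _ hp]
    simp only [← ENNReal.rpow_natCast, ← ENNReal.rpow_mul, mul_assoc, mul_comm p]
  have hratio : (2 : ℝ≥0∞) * (2 ^ (α * p) * 2⁻¹ ^ q) = 2 ^ (1 + α * p - q) := by
    rw [sub_eq_add_neg, ENNReal.rpow_add _ _ two_ne_zero (by simp),
      ENNReal.rpow_add _ _ two_ne_zero (by simp), ENNReal.rpow_one, ENNReal.inv_rpow,
      ENNReal.rpow_neg, mul_assoc]
  simp_rw [hrpow, lintegral_const_mul' _ _ (two_rpow_pow_ne_top _ _)]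
  calc _ ≤ ∑ _k ∈ Finset.range (2 ^ n), (2 ^ (α * p)) ^ n * (A * (2⁻¹ ^ q) ^ n) := by
        gcongr with k hk
        exact hmom k (Finset.mem_range.1 hk)
    _ = A * (2 * (2 ^ (α * p) * 2⁻¹ ^ q)) ^ n := by
      rw [Finset.sum_const, Finset.card_range, nsmul_eq_mul]
      push_cast
      ring
    _ = A * (2 ^ (1 + α * p - q)) ^ n := by rw [hratio]

theorem ae_exists_le_of_lintegral_rpow_le {Y : ℕ → ℕ → Ω → ℝ≥0∞} {A : ℝ≥0∞} {α : ℝ}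
    (hp : 0 < p) (hq : 1 + α * p < q) (hA : A ≠ ∞)
    (hY : ∀ n, ∀ k < 2 ^ n, AEMeasurable (Y n k) P)
    (hmom : ∀ n, ∀ k < 2 ^ n, ∫⁻ ω, Y n k ω ^ p ∂P ≤ A * (2⁻¹ ^ q) ^ n) :
    ∀ᵐ ω ∂P, ∃ C ≠ ∞, ∀ n, ∀ k < 2 ^ n, Y n k ω ≤ C * (2⁻¹ ^ α) ^ n := by
  have hratio : (2 : ℝ≥0∞) ^ (1 + α * p - q) < 1 :=
    ENNReal.rpow_lt_one_of_one_lt_of_neg (by norm_num) (by linarith)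
  have hsum : ∑' n, ∑ k ∈ Finset.range (2 ^ n), ∫⁻ ω, ((2 ^ α) ^ n * Y n k ω) ^ p ∂P ≠ ∞ := by
    refine ne_top_of_le_ne_top ?_
      (ENNReal.tsum_le_tsum fun n => sum_lintegral_rpow_le hp.le α (hmom n))
    rw [ENNReal.tsum_mul_left, ENNReal.tsum_geometric]
    exact ENNReal.mul_ne_top hA (ENNReal.inv_ne_top.2 (tsub_pos_of_lt hratio).ne')
  filter_upwards [ae_exists_le_of_tsum_lintegral_ne_top
    (fun n k hk => ((hY n k hk).const_mul _).pow_const p) hsum] with ω ⟨C, hC, hω⟩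
  refine ⟨C ^ p⁻¹, by finiteness, fun n k hk => ?_⟩
  have hscaled := (ENNReal.le_rpow_inv_iff hp).2 (hω n k hk)
  rwa [ENNReal.inv_rpow, ← ENNReal.inv_pow, ← div_eq_mul_inv, ENNReal.le_div_iff_mul_le
    (.inl (by positivity)) (.inl (two_rpow_pow_ne_top _ _)), mul_comm]

variable {E : Type*} [PseudoEMetricSpace E] {X : ℝ → Ω → E} {T : ℝ} {M : ℝ≥0} {α : ℝ≥0}

theorem lintegral_edist_dyadic_le (hT : 0 ≤ T)
    (hX : IsAEKolmogorovProcess (fun t : Icc 0 T => X t) P p q M) {n k : ℕ} (hk : k < 2 ^ n) :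
    ∫⁻ ω, edist (X (T * (k / 2 ^ n)) ω) (X (T * ((k + 1 : ℕ) / 2 ^ n)) ω) ^ p ∂P
      ≤ M * ENNReal.ofReal T ^ q * (2⁻¹ ^ q) ^ n := by
  have hmem {k : ℕ} (hk : k ≤ 2 ^ n) : T * (k / 2 ^ n) ∈ Icc 0 T :=
    ⟨by positivity, mul_le_of_le_one_right hT (div_two_pow_mem_Icc hk).2⟩
  have hdist :
      edist (T * (k / 2 ^ n)) (T * ((k + 1 : ℕ) / 2 ^ n)) = ENNReal.ofReal T * 2⁻¹ ^ n := by
    rw [edist_comm, edist_dist, Real.dist_eq, ← mul_sub, ← sub_div]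
    push_cast
    rw [add_sub_cancel_left, abs_of_nonneg (by positivity), ENNReal.ofReal_mul hT, ← inv_eq_one_div,
      ← inv_pow]
    simp [ENNReal.ofReal_inv_of_pos, ENNReal.inv_pow]
  refine (hX.kolmogorovCondition ⟨_, hmem hk.le⟩ ⟨_, hmem hk⟩).trans_eq ?_
  rw [Subtype.edist_eq, hdist, ENNReal.mul_rpow_of_nonneg _ _ hX.q_pos.le, mul_assoc,
    ← ENNReal.rpow_natCast, ← ENNReal.rpow_mul, mul_comm (n : ℝ), ENNReal.rpow_mul,
    ENNReal.rpow_natCast]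

theorem ae_exists_holderOnWith_of_isAEKolmogorovProcess (hT : 0 < T)
    (hX : IsAEKolmogorovProcess (fun t : Icc 0 T => X t) P p q M) (hα : 0 < α)
    (hq : 1 + α * p < q) (hcont : ∀ᵐ ω ∂P, ContinuousOn (fun t => X t ω) (Icc 0 T)) :
    ∀ᵐ ω ∂P, ∃ K, HolderOnWith K α (fun t => X t ω) (Icc 0 T) := by
  have hmem {u : ℝ} (hu : u ∈ Icc 0 1) : T * u ∈ Icc 0 T :=
    ⟨mul_nonneg hT.le hu.1, mul_le_of_le_one_right hT.le hu.2⟩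
  have hincr := ae_exists_le_of_lintegral_rpow_le
    (Y := fun n k ω => edist (X (T * (k / 2 ^ n)) ω) (X (T * ((k + 1 : ℕ) / 2 ^ n)) ω))
    hX.p_pos hq (by finiteness [hX.q_pos.le])
    (fun n k hk => hX.aemeasurable_edist
      (s := ⟨_, hmem (div_two_pow_mem_Icc hk.le)⟩) (t := ⟨_, hmem (div_two_pow_mem_Icc hk)⟩))
    (fun n k hk => lintegral_edist_dyadic_le hT.le hX hk)
  filter_upwards [hincr, hcont] with ω ⟨C, hC, hω⟩ hc
  obtain ⟨K, hK⟩ := exists_holderOnWith_of_edist_dyadic_le (f := fun u => X (T * u) ω) hα hC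
    (hc.comp (by fun_prop) fun u => hmem) hω
  have hscale : HolderOnWith ‖T⁻¹‖₊ 1 (fun t => T⁻¹ * t) (Icc 0 T) :=
    (lipschitzWith_smul T⁻¹).holderWith.holderOnWith _
  have hmaps : MapsTo (fun t => T⁻¹ * t) (Icc 0 T) (Icc 0 1) := fun t ht =>
    ⟨by have := ht.1; positivity, inv_mul_le_one_of_le₀ ht.2 hT.le⟩
  refine ⟨K * ‖T⁻¹‖₊ ^ (α : ℝ), ?_⟩
  have := hK.comp hscale hmaps
  simpa [Function.comp_def, hT.ne'] using this

end KolmogorovContinuity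

section GaussianHolder

theorem lintegral_enorm_rpow_gaussianReal (v : ℝ≥0) {p : ℝ} (hp : 0 ≤ p) :
    ∫⁻ x, ‖x‖ₑ ^ p ∂(gaussianReal 0 v)
      = (∫⁻ x, ‖x‖ₑ ^ p ∂(gaussianReal 0 1)) * (v : ℝ≥0∞) ^ (p / 2) := by
  have hscale : gaussianReal 0 v = (gaussianReal 0 1).map (√v * ·) := by
    rw [gaussianReal_map_const_mul, mul_zero, mul_one]
    congr 1
    ext
    simp
  have hsqrt : ‖√(v : ℝ)‖ₑ ^ p = (v : ℝ≥0∞) ^ (p / 2) := by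
    rw [Real.enorm_eq_ofReal (Real.sqrt_nonneg _), Real.sqrt_eq_rpow,
      ← ENNReal.ofReal_rpow_of_nonneg v.coe_nonneg (by norm_num), ← ENNReal.rpow_mul,
      ENNReal.ofReal_coe_nnreal, one_div_mul_eq_div]
  rw [hscale, lintegral_map (by fun_prop) (by fun_prop)]
  simp_rw [enorm_mul, ENNReal.mul_rpow_of_nonneg _ _ hp, hsqrt]
  rw [lintegral_const_mul' _ _ (by finiteness), mul_comm]

theorem lintegral_enorm_rpow_gaussianReal_ne_top (v : ℝ≥0) {p : ℝ≥0} (hp : p ≠ 0) :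
    ∫⁻ x, ‖x‖ₑ ^ (p : ℝ) ∂(gaussianReal 0 v) ≠ ∞ :=
  (lintegral_rpow_enorm_lt_top_of_eLpNorm_lt_top (by simpa using hp) (by simp)
    (memLp_id_gaussianReal (μ := 0) (v := v) p).2).ne

variable {ι Ω : Type*} [MeasurableSpace Ω] {P : Measure Ω}

theorem isAEKolmogorovProcess_of_isGaussianProcess [PseudoEMetricSpace ι] {X : ι → Ω → ℝ} {h : ℝ}
    {p : ℝ≥0}
    (hp : 0 < p) (hh : 0 < h) (hX : IsGaussianProcess X P) (hmean : ∀ t, P[X t] = 0)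
    (hvar : ∀ s t, ENNReal.ofReal (Var[X t - X s; P]) = edist s t ^ (2 * h)) :
    IsAEKolmogorovProcess X P p (p * h) (∫⁻ x, ‖x‖ₑ ^ (p : ℝ) ∂(gaussianReal 0 1)).toNNReal := by
  have := hX.isProbabilityMeasure
  have hmom (s t : ι) : ∫⁻ ω, edist (X s ω) (X t ω) ^ (p : ℝ) ∂P
      = (∫⁻ x, ‖x‖ₑ ^ (p : ℝ) ∂(gaussianReal 0 1)) * edist s t ^ (p * h) := by
    have hlaw : HasGaussianLaw (X t - X s) P := hX.hasGaussianLaw_sub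
    have hint (t : ι) : Integrable (X t) P := (hX.hasGaussianLaw_eval t).integrable
    have hmean_sub : ∫ ω, (X t - X s) ω ∂P = 0 := by
      simp only [Pi.sub_apply]
      rw [integral_sub (hint t) (hint s), hmean, hmean, sub_zero]
    calc ∫⁻ ω, edist (X s ω) (X t ω) ^ (p : ℝ) ∂P
      _ = ∫⁻ x, ‖x‖ₑ ^ (p : ℝ) ∂(P.map (X t - X s)) := by
        rw [lintegral_map' (by fun_prop) hlaw.aemeasurable]
        simp_rw [Pi.sub_apply, ← edist_eq_enorm_sub, edist_comm]
      _ = ∫⁻ x, ‖x‖ₑ ^ (p : ℝ) ∂(gaussianReal 0 Var[X t - X s; P].toNNReal) := by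
        rw [hlaw.map_eq_gaussianReal, hmean_sub]
      _ = _ := by
        rw [lintegral_enorm_rpow_gaussianReal _ p.coe_nonneg]
        change _ * ENNReal.ofReal _ ^ _ = _
        rw [hvar, ← ENNReal.rpow_mul]
        congr 2
        ring
  refine ⟨fun t => (hX.aemeasurable t).mk (X t), IsKolmogorovProcess.mk_of_secondCountableTopology
    (fun t => (hX.aemeasurable t).measurable_mk) (fun s t => ?_) (mod_cast hp) (by positivity),
    fun t => (hX.aemeasurable t).ae_eq_mk⟩
  rw [ENNReal.coe_toNNReal (lintegral_enorm_rpow_gaussianReal_ne_top _ hp.ne'), ← hmom]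
  refine (lintegral_congr_ae ?_).le
  filter_upwards [(hX.aemeasurable s).ae_eq_mk, (hX.aemeasurable t).ae_eq_mk] with ω hs ht
  rw [← hs, ← ht]

theorem ae_exists_holderOnWith_of_isGaussianProcess {X : ℝ → Ω → ℝ} {T h : ℝ} {α : ℝ≥0}
    (hT : 0 < T) (hα : 0 < α) (hαh : α < h)
    (hX : IsGaussianProcess (fun (t : Icc 0 T) ω => X t ω) P)
    (hmean : ∀ t ∈ Icc 0 T, P[X t] = 0)
    (hvar : ∀ s ∈ Icc 0 T, ∀ t ∈ Icc 0 T, Var[X t - X s; P] = |t - s| ^ (2 * h))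
    (hcont : ∀ᵐ ω ∂P, ContinuousOn (fun t => X t ω) (Icc 0 T)) :
    ∀ᵐ ω ∂P, ∃ K, HolderOnWith K α (fun t => X t ω) (Icc 0 T) := by
  have hh : 0 < h := α.coe_nonneg.trans_lt hαh
  obtain ⟨p, hp⟩ := exists_nat_gt (1 / (h - α))
  rw [div_lt_iff₀ (by linarith)] at hp
  have hp0 : 0 < p := by
    refine Nat.pos_of_ne_zero fun h0 => ?_
    norm_num [h0] at hp
  refine ae_exists_holderOnWith_of_isAEKolmogorovProcess hT
    (isAEKolmogorovProcess_of_isGaussianProcess (p := p) (h := h) (mod_cast hp0) hh hX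
      (fun t => hmean t t.2) fun s t => ?_) hα ?_ hcont
  · rw [edist_comm, Subtype.edist_eq, edist_dist, Real.dist_eq, ENNReal.ofReal_rpow_of_nonneg
      (abs_nonneg _) (by positivity)]
    exact congrArg _ (hvar s s.2 t t.2)
  · push_cast
    linarith

end GaussianHolder

section BrownianPaths

variable {Ω : Type*} [MeasurableSpace Ω] {P : Measure Ω} {X : ℝ → Ω → ℝ} {H T : ℝ}

theorem IsStandardBrownianMotionOn.isFractionalBrownianMotionOn
    (hX : IsStandardBrownianMotionOn X T P) : IsFractionalBrownianMotionOn X (1 / 2) T P where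
  gaussian := hX.gaussian
  mean_zero := hX.mean_zero
  covariance s hs t ht := by
    rw [hX.covariance s hs t ht, mul_one_div_cancel two_ne_zero, Real.rpow_one, Real.rpow_one,
      Real.rpow_one]
    rcases le_total s t with h | h
    · rw [min_eq_left h, abs_of_nonneg (sub_nonneg.2 h)]
      ring
    · rw [min_eq_right h, abs_of_nonpos (sub_nonpos.2 h)]
      ring
  continuous := hX.continuous

namespace IsFractionalBrownianMotionOn

theorem variance_sub_eq (hX : IsFractionalBrownianMotionOn X H T P) (hH : H ≠ 0) {s t : ℝ}
    (hs : s ∈ Icc 0 T) (ht : t ∈ Icc 0 T) : Var[X t - X s; P] = |t - s| ^ (2 * H) := by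
  have := hX.gaussian.isProbabilityMeasure
  have hL {t : ℝ} (ht : t ∈ Icc 0 T) : MemLp (X t) 2 P :=
    (hX.gaussian.hasGaussianLaw_eval ⟨t, ht⟩).memLp_two
  have hzero : (0 : ℝ) ^ (2 * H) = 0 := Real.zero_rpow (by simpa using hH)
  rw [variance_sub (hL ht) (hL hs), ← covariance_self (hL ht).aemeasurable,
    ← covariance_self (hL hs).aemeasurable, hX.covariance _ ht _ ht, hX.covariance _ hs _ hs,
    hX.covariance _ ht _ hs, sub_self, sub_self, abs_zero, hzero, abs_sub_comm s t]
  ring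

theorem ae_exists_holderOnWith (hX : IsFractionalBrownianMotionOn X H T P) (hT : 0 < T) {α : ℝ≥0}
    (hα : 0 < α) (hαH : α < H) :
    ∀ᵐ ω ∂P, ∃ K, HolderOnWith K α (fun t => X t ω) (Icc 0 T) :=
  ae_exists_holderOnWith_of_isGaussianProcess hT hα hαH hX.gaussian hX.mean_zero
    (fun _ hs _ ht => hX.variance_sub_eq (α.coe_nonneg.trans_lt hαH).ne' hs ht) hX.continuous

theorem ae_zero (hX : IsFractionalBrownianMotionOn X H T P) (hT : 0 ≤ T) (hH : H ≠ 0) :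
    ∀ᵐ ω ∂P, X 0 ω = 0 := by
  have := hX.gaussian.isProbabilityMeasure
  have h0 : (0 : ℝ) ∈ Icc 0 T := left_mem_Icc.2 hT
  have hL : MemLp (X 0) 2 P := (hX.gaussian.hasGaussianLaw_eval ⟨0, h0⟩).memLp_two
  have hvar : Var[X 0; P] = 0 := by
    rw [← covariance_self hL.aemeasurable, hX.covariance _ h0 _ h0]
    simp [hH]
  simpa [hX.mean_zero 0 h0] using ae_eq_integral_of_variance_eq_zero hL hvar

end IsFractionalBrownianMotionOn

end BrownianPaths

section PhiPath

variable {w w' : ℝ → ℝ} {T t : ℝ}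

theorem norm_cexp_I_mul_mul_ofReal_sub (x s t : ℝ) :
    ‖Complex.exp (Complex.I * x * (t - s))‖ = 1 := by
  rw [mul_assoc, ← Complex.ofReal_sub, ← Complex.ofReal_mul]
  exact Complex.norm_exp_I_mul_ofReal _

theorem cexp_I_mul_mul_sub (x s t : ℝ) :
    Complex.exp (Complex.I * x * (t - s))
      = Complex.exp (Complex.I * x * t) * Complex.exp (Complex.I * (-x : ℝ) * s) := by
  rw [← Complex.exp_add]
  push_cast
  ring_nf

theorem phiPath_eq (w : ℝ → ℝ) (t x : ℝ) :
    phiPath w t x = w t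
      + Complex.I * x * ∫ s in (0 : ℝ)..t, Complex.exp (Complex.I * x * (t - s)) * w s := by
  have hint : ∫ s in (0 : ℝ)..t, Complex.exp (Complex.I * x * (t - s)) * w s
      = Complex.exp (Complex.I * x * t)
        * ∫ s in (0 : ℝ)..t, (w s : ℂ) * Complex.exp (Complex.I * (-x : ℝ) * s) := by
    simp only [← intervalIntegral.integral_const_mul, cexp_I_mul_mul_sub]
    congr with s
    ring
  have hone := cexp_I_mul_mul_sub x t t
  rw [sub_self, mul_zero, Complex.exp_zero] at hone
  rw [phiPath, pathExpIntegral, hint]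
  push_cast at hone ⊢
  linear_combination -(w t : ℂ) * hone

theorem phiPath_congr (h : EqOn w w' (Icc 0 t)) (ht : 0 ≤ t) (x : ℝ) :
    phiPath w t x = phiPath w' t x := by
  rw [phiPath_eq, phiPath_eq, h (right_mem_Icc.2 ht)]
  congr 2
  refine intervalIntegral.integral_congr fun s hs => ?_
  rw [uIcc_of_le ht] at hs
  simp only [h hs]

theorem norm_phiPath_le {M : ℝ} (hM : ∀ s ∈ Icc 0 T, |w s| ≤ M) (ht : t ∈ Icc 0 T) (x : ℝ) :
    ‖phiPath w t x‖ ≤ M * (1 + T * |x|) := by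
  have hM0 : 0 ≤ M := (abs_nonneg _).trans (hM t ht)
  have hint : ‖∫ s in (0 : ℝ)..t, Complex.exp (Complex.I * x * (t - s)) * w s‖ ≤ M * |t - 0| := by
    refine intervalIntegral.norm_integral_le_of_norm_le_const fun s hs => ?_
    rw [uIoc_of_le ht.1] at hs
    rw [norm_mul, norm_cexp_I_mul_mul_ofReal_sub, one_mul, Complex.norm_real]
    exact hM s ⟨hs.1.le, hs.2.trans ht.2⟩
  rw [sub_zero, abs_of_nonneg ht.1] at hint
  rw [phiPath_eq]
  calc _ ≤ ‖(w t : ℂ)‖ + |x| * (M * t) := by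
        refine (norm_add_le _ _).trans (add_le_add_right ?_ _)
        rw [norm_mul, norm_mul, Complex.norm_I, one_mul, Complex.norm_real, Real.norm_eq_abs]
        gcongr
    _ ≤ M + |x| * (M * T) := by
      rw [Complex.norm_real]
      gcongr
      exacts [hM t ht, ht.2]
    _ = M * (1 + T * |x|) := by ring

theorem continuous_phiPath (hw : Continuous w) :
    Continuous fun p : ℝ × ℝ => phiPath w p.1 p.2 := by
  have hint : Continuous fun p : ℝ × ℝ =>
      ∫ s in (0 : ℝ)..p.1, Complex.exp (Complex.I * p.2 * (p.1 - s)) * w s :=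
    intervalIntegral.continuous_parametric_intervalIntegral_of_continuous
      (f := fun (p : ℝ × ℝ) s => Complex.exp (Complex.I * p.2 * (p.1 - s)) * w s)
      (by fun_prop) continuous_fst
  simp only [phiPath_eq]
  fun_prop

theorem exists_continuous_eqOn_Icc (hw : ContinuousOn w (Icc 0 T)) (hT : 0 ≤ T) :
    ∃ w', Continuous w' ∧ EqOn w w' (Icc 0 T) :=
  ⟨IccExtend hT ((Icc 0 T).domRestrict w), hw.domRestrict.Icc_extend', fun _ hs =>
    by rw [IccExtend_of_mem hT _ hs]; rfl⟩

theorem continuousOn_phiPath (hw : ContinuousOn w (Icc 0 T)) :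
    ContinuousOn (fun p : ℝ × ℝ => phiPath w p.1 p.2) (Icc 0 T ×ˢ univ) := by
  rcases lt_or_ge T 0 with hT | hT
  · simp [Icc_eq_empty_of_lt hT]
  obtain ⟨w', hw', heq⟩ := exists_continuous_eqOn_Icc hw hT
  exact (continuous_phiPath hw').continuousOn.congr fun p hp =>
    phiPath_congr (heq.mono (Icc_subset_Icc_right hp.1.2)) hp.1.1 p.2

theorem hasDerivAt_phiPath_sub (hw : Continuous w) (x t : ℝ) :
    HasDerivAt (fun t => phiPath w t x - w t) (Complex.I * x * phiPath w t x) t := by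
  have hexp : HasDerivAt (fun t : ℝ => Complex.exp (Complex.I * x * t))
      (Complex.exp (Complex.I * x * t) * (Complex.I * x)) t := by
    simpa using ((hasDerivAt_id (t : ℂ)).const_mul (Complex.I * x)).cexp.comp_ofReal
  have hcont : Continuous fun s : ℝ => Complex.exp (Complex.I * (-x : ℝ) * s) * w s := by fun_prop
  have hint := intervalIntegral.integral_hasDerivAt_right (hcont.intervalIntegrable 0 t)
    hcont.aestronglyMeasurable.stronglyMeasurableAtFilter hcont.continuousAt
  have hone := cexp_I_mul_mul_sub x t t
  rw [sub_self, mul_zero, Complex.exp_zero] at hone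
  simp only [phiPath_eq, cexp_I_mul_mul_sub, mul_assoc (Complex.exp (Complex.I * x * _)),
    intervalIntegral.integral_const_mul, add_sub_cancel_left]
  convert! (hexp.mul hint).const_mul (Complex.I * x) using 1
  linear_combination (Complex.I * x * w t) * hone

theorem phiPath_eq_add_integral (hw : ContinuousOn w (Icc 0 t)) (ht : 0 ≤ t) (x : ℝ) :
    phiPath w t x = w t + ∫ s in (0 : ℝ)..t, Complex.I * x * phiPath w s x := by
  obtain ⟨w', hw', heq⟩ := exists_continuous_eqOn_Icc hw ht
  have hcongr {s : ℝ} (hs : s ∈ Icc 0 t) : phiPath w s x = phiPath w' s x :=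
    phiPath_congr (heq.mono (Icc_subset_Icc_right hs.2)) hs.1 x
  have hcont : Continuous fun s => Complex.I * x * phiPath w' s x :=
    ((continuous_phiPath hw').comp (by fun_prop : Continuous fun s : ℝ => (s, x))).const_mul _
  have hFTC := intervalIntegral.integral_eq_sub_of_hasDerivAt
    (fun s _ => hasDerivAt_phiPath_sub hw' x s) (hcont.intervalIntegrable 0 t)
  have hint : ∫ s in (0 : ℝ)..t, Complex.I * x * phiPath w s x
      = ∫ s in (0 : ℝ)..t, Complex.I * x * phiPath w' s x := by
    refine intervalIntegral.integral_congr fun s hs => ?_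
    rw [uIcc_of_le ht] at hs
    simp only [hcongr hs]
  rw [hint, hFTC, hcongr (right_mem_Icc.2 ht), heq (right_mem_Icc.2 ht), phiPath_eq w' 0]
  simp

theorem hasRSIntegral_phiPath (ht : 0 ≤ t) (hw : ContinuousOn w (Icc 0 t)) (hw0 : w 0 = 0)
    (x : ℝ) :
    HasRSIntegral (fun s => Complex.exp (Complex.I * x * (t - s))) w 0 t (phiPath w t x) := by
  have hderiv (s : ℝ) : HasDerivAt (fun s : ℝ => Complex.exp (Complex.I * x * (t - s)))
      (-(Complex.I * x) * Complex.exp (Complex.I * x * (t - s))) s := by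
    have := (((hasDerivAt_id (s : ℂ)).const_sub (t : ℂ)).const_mul
      (Complex.I * x)).cexp.comp_ofReal
    simpa [mul_comm] using this
  have hcont : Continuous fun s : ℝ =>
      -(Complex.I * x) * Complex.exp (Complex.I * x * (t - s)) := by fun_prop
  convert! hasRSIntegral_of_sub_eq_integral
    (f := fun s : ℝ => Complex.exp (Complex.I * x * (t - s))) ht hw
    (hcont.intervalIntegrable 0 t) fun s _ u _ =>
      (intervalIntegral.integral_eq_sub_of_hasDerivAt (fun v _ => hderiv v)
        (hcont.intervalIntegrable s u)).symm using 1
  simp only [phiPath_eq, hw0, mul_left_comm (w _ : ℂ), intervalIntegral.integral_const_mul,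
    sub_self, mul_zero, Complex.exp_zero, Complex.ofReal_zero, mul_comm (w _ : ℂ)]
  ring

end PhiPath

section FubiniPrimitive

variable {E : Type*} [MeasurableSpace E] {μ : Measure E} {h : ℝ → E → ℂ} {g : ℝ → ℝ}
  {a b t : ℝ}

theorem integrable_uncurry_continuousOn_mul {φ : ℝ → ℂ} (hφ : ContinuousOn φ (Icc a b))
    (hh : Integrable (Function.uncurry h) ((volume.restrict (Ioc a b)).prod μ)) :
    Integrable (Function.uncurry fun s x => φ s * h s x)
      ((volume.restrict (Ioc a b)).prod μ) := by
  obtain ⟨C, hC⟩ := isCompact_Icc.exists_bound_of_continuousOn hφ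
  have hφm : AEStronglyMeasurable φ (volume.restrict (Ioc a b)) :=
    (hφ.mono Ioc_subset_Icc_self).aestronglyMeasurable measurableSet_Ioc
  refine hh.bdd_mul (c := C) hφm.comp_fst ?_
  refine Measure.quasiMeasurePreserving_fst.ae (p := fun s => ‖φ s‖ ≤ C) ?_
  filter_upwards [ae_restrict_mem measurableSet_Ioc] with s hs using hC s (Ioc_subset_Icc_self hs)

variable [SFinite μ]

theorem integrable_uncurry_restrict_Ioc_of_le
    (hh : Integrable (Function.uncurry h) ((volume.restrict (Ioc a b)).prod μ)) (ht : t ≤ b) :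
    Integrable (Function.uncurry h) ((volume.restrict (Ioc a t)).prod μ) :=
  hh.mono_measure
    (Measure.prod_mono (Measure.restrict_mono (Ioc_subset_Ioc_right ht) le_rfl) le_rfl)

theorem integrable_intervalIntegral_of_prod (hab : a ≤ b)
    (hh : Integrable (Function.uncurry h) ((volume.restrict (Ioc a b)).prod μ)) :
    Integrable (fun x => ∫ s in a..b, h s x) μ := by
  simpa only [intervalIntegral.integral_of_le hab] using! hh.integral_prod_right

theorem hasRSIntegral_integral_primitive (hab : a ≤ b) (hg : ContinuousOn g (Icc a b))
    (hh : Integrable (Function.uncurry h) ((volume.restrict (Ioc a b)).prod μ)) :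
    HasRSIntegral (fun t => ∫ x, (∫ s in a..t, h s x) ∂μ) g a b
      (∫ x, (∫ s in a..b, ((g b - g s : ℝ) : ℂ) * h s x) ∂μ) := by
  have hφ : ContinuousOn (fun s => ((g b - g s : ℝ) : ℂ)) (Icc a b) := by fun_prop
  have hη : IntervalIntegrable (fun s => ∫ x, h s x ∂μ) volume a b :=
    (intervalIntegrable_iff_integrableOn_Ioc_of_le hab).2 hh.integral_prod_left
  have hswap {k : ℝ → E → ℂ} {t : ℝ} (ht : a ≤ t)
      (hk : Integrable (Function.uncurry k) ((volume.restrict (Ioc a t)).prod μ)) :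
      ∫ s in a..t, ∫ x, k s x ∂μ = ∫ x, (∫ s in a..t, k s x) ∂μ :=
    intervalIntegral_integral_swap (by rwa [uIoc_of_le ht])
  convert! (hasRSIntegral_primitive hab hg hη).congr (fun t ht =>
    hswap ht.1 (integrable_uncurry_restrict_Ioc_of_le hh ht.2)) (eqOn_refl g _) using 1
  rw [← hswap hab (integrable_uncurry_continuousOn_mul hφ hh)]
  simp only [integral_const_mul]

end FubiniPrimitive

section PhiFubini

variable {w b : ℝ → ℝ} {T t : ℝ} {μ : Measure ℝ} {g : ℝ → ℂ}

theorem norm_I_mul_mul_phiPath_le {M : ℝ} (hM : ∀ s ∈ Icc 0 T, |w s| ≤ M) (ht : t ∈ Icc 0 T)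
    (x : ℝ) : ‖Complex.I * x * phiPath w t x‖ ≤ M * (1 + T) * (1 + x ^ 2) := by
  have hM0 : 0 ≤ M := (abs_nonneg _).trans (hM t ht)
  have hT : 0 ≤ T := ht.1.trans ht.2
  rw [norm_mul, norm_mul, Complex.norm_I, one_mul, Complex.norm_real, Real.norm_eq_abs]
  calc |x| * ‖phiPath w t x‖ ≤ |x| * (M * (1 + T * |x|)) := by grw [norm_phiPath_le hM ht x]
    _ = M * (|x| + T * x ^ 2) := by rw [← sq_abs x]; ring
    _ ≤ M * ((1 + x ^ 2) + T * (1 + x ^ 2)) := by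
      gcongr
      · nlinarith [sq_nonneg (|x| - 1), sq_abs x, abs_nonneg x]
      · linarith
    _ = M * (1 + T) * (1 + x ^ 2) := by ring

theorem integrable_uncurry_phiPath_mul [SFinite μ] (hw : ContinuousOn w (Icc 0 T))
    (hg : Integrable g μ) (hg2 : Integrable (fun x : ℝ => (x : ℂ) ^ 2 * g x) μ) :
    Integrable (Function.uncurry fun s x => Complex.I * x * phiPath w s x * g x)
      ((volume.restrict (Ioc 0 T)).prod μ) := by
  obtain ⟨M, hM⟩ := isCompact_Icc.exists_bound_of_continuousOn hw
  have hφ : AEStronglyMeasurable (fun p : ℝ × ℝ => Complex.I * p.2 * phiPath w p.1 p.2)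
      ((volume.restrict (Ioc 0 T)).prod μ) := by
    rw [← Measure.restrict_univ (μ := μ), Measure.prod_restrict]
    have hcont : ContinuousOn (fun p : ℝ × ℝ => Complex.I * p.2 * phiPath w p.1 p.2)
        (Icc 0 T ×ˢ univ) := (by fun_prop : Continuous fun p : ℝ × ℝ =>
          Complex.I * (p.2 : ℂ)).continuousOn.mul (continuousOn_phiPath hw)
    exact (hcont.mono (prod_mono_left Ioc_subset_Icc_self)).aestronglyMeasurable
      (measurableSet_Ioc.prod .univ)
  have hdom : Integrable (fun p : ℝ × ℝ => M * (1 + T) * (‖g p.2‖ + ‖(p.2 : ℂ) ^ 2 * g p.2‖))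
      ((volume.restrict (Ioc 0 T)).prod μ) :=
    ((hg.norm.add hg2.norm).const_mul _).comp_snd _
  refine hdom.mono' (hφ.mul hg.aestronglyMeasurable.comp_snd) ?_
  have hmem : ∀ᵐ p ∂(volume.restrict (Ioc 0 T)).prod μ, p.1 ∈ Icc 0 T :=
    Measure.quasiMeasurePreserving_fst.ae
      ((ae_restrict_mem measurableSet_Ioc).mono fun _ hs => Ioc_subset_Icc_self hs)
  filter_upwards [hmem] with p hp
  calc ‖Complex.I * p.2 * phiPath w p.1 p.2 * g p.2‖
      ≤ M * (1 + T) * (1 + p.2 ^ 2) * ‖g p.2‖ := by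
        rw [norm_mul]
        grw [norm_I_mul_mul_phiPath_le hM hp p.2]
    _ = M * (1 + T) * (‖g p.2‖ + ‖(p.2 : ℂ) ^ 2 * g p.2‖) := by
      rw [norm_mul, norm_pow, Complex.norm_real, Real.norm_eq_abs, sq_abs]
      ring

theorem phiPath_mul_eq (hw : ContinuousOn w (Icc 0 T)) (ht : t ∈ Icc 0 T) (x : ℝ) (z : ℂ) :
    phiPath w t x * z = w t * z + ∫ s in (0 : ℝ)..t, Complex.I * x * phiPath w s x * z := by
  rw [phiPath_eq_add_integral (hw.mono (Icc_subset_Icc_right ht.2)) ht.1 x, add_mul,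
    intervalIntegral.integral_mul_const]

theorem integrable_phiPath_mul [SFinite μ] (hw : ContinuousOn w (Icc 0 T)) (hg : Integrable g μ)
    (hg2 : Integrable (fun x : ℝ => (x : ℂ) ^ 2 * g x) μ) (ht : t ∈ Icc 0 T) :
    Integrable (fun x => phiPath w t x * g x) μ := by
  simp only [phiPath_mul_eq hw ht]
  exact (hg.const_mul _).add (integrable_intervalIntegral_of_prod ht.1
    (integrable_uncurry_restrict_Ioc_of_le (integrable_uncurry_phiPath_mul hw hg hg2) ht.2))

theorem hasRSIntegral_phiPath_right (hT : 0 ≤ T) (hw : ContinuousOn w (Icc 0 T))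
    (hb : ContinuousOn b (Icc 0 T)) (hwb : RSIntegrable (fun t => (w t : ℂ)) b 0 T) (x : ℝ) :
    HasRSIntegral (fun t => phiPath w t x) b 0 T (rsIntegral (fun t => (w t : ℂ)) b 0 T
      + ∫ s in (0 : ℝ)..T, ((b T - b s : ℝ) : ℂ) * (Complex.I * x * phiPath w s x)) := by
  have hcont : ContinuousOn (fun s => Complex.I * x * phiPath w s x) (Icc 0 T) :=
    ((continuousOn_phiPath hw).comp (f := fun s => (s, x)) (by fun_prop)
      fun s hs => ⟨hs, mem_univ x⟩).const_mul _
  refine ((hwb.hasRSIntegral hT).add (hasRSIntegral_primitive hT hb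
    (hcont.intervalIntegrable_of_Icc hT))).congr (fun t ht => ?_) (eqOn_refl b _)
  exact (phiPath_eq_add_integral (hw.mono (Icc_subset_Icc_right ht.2)) ht.1 x).symm

theorem rsIntegral_phiPath_mul (hT : 0 ≤ T) (hw : ContinuousOn w (Icc 0 T))
    (hb : ContinuousOn b (Icc 0 T)) (hwb : RSIntegrable (fun t => (w t : ℂ)) b 0 T) (x : ℝ)
    (z : ℂ) :
    rsIntegral (fun t => phiPath w t x) b 0 T * z = rsIntegral (fun t => (w t : ℂ)) b 0 T * z
      + ∫ s in (0 : ℝ)..T, ((b T - b s : ℝ) : ℂ) * (Complex.I * x * phiPath w s x * z) := by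
  rw [(hasRSIntegral_phiPath_right hT hw hb hwb x).rsIntegral_eq hT, add_mul]
  simp only [← intervalIntegral.integral_mul_const, mul_assoc]

theorem integrable_rsIntegral_phiPath_mul [SFinite μ] (hT : 0 ≤ T)
    (hw : ContinuousOn w (Icc 0 T)) (hb : ContinuousOn b (Icc 0 T))
    (hwb : RSIntegrable (fun t => (w t : ℂ)) b 0 T) (hg : Integrable g μ)
    (hg2 : Integrable (fun x : ℝ => (x : ℂ) ^ 2 * g x) μ) :
    Integrable (fun x => rsIntegral (fun t => phiPath w t x) b 0 T * g x) μ := by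
  simp only [rsIntegral_phiPath_mul hT hw hb hwb]
  exact (hg.const_mul _).add (integrable_intervalIntegral_of_prod hT
    (integrable_uncurry_continuousOn_mul (by fun_prop) (integrable_uncurry_phiPath_mul hw hg hg2)))

theorem hasRSIntegral_integral_phiPath_mul [SFinite μ] (hT : 0 ≤ T)
    (hw : ContinuousOn w (Icc 0 T)) (hb : ContinuousOn b (Icc 0 T))
    (hwb : RSIntegrable (fun t => (w t : ℂ)) b 0 T) (hg : Integrable g μ)
    (hg2 : Integrable (fun x : ℝ => (x : ℂ) ^ 2 * g x) μ) :
    HasRSIntegral (fun t => ∫ x, phiPath w t x * g x ∂μ) b 0 T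
      (∫ x, rsIntegral (fun t => phiPath w t x) b 0 T * g x ∂μ) := by
  have hk := integrable_uncurry_phiPath_mul hw hg hg2
  have hsum := ((hwb.hasRSIntegral hT).const_mul (∫ x, g x ∂μ)).add
    (hasRSIntegral_integral_primitive hT hb hk)
  convert! hsum.congr (fun t ht => ?_) (eqOn_refl b _) using 1
  · simp only [rsIntegral_phiPath_mul hT hw hb hwb]
    rw [integral_add (hg.const_mul _) (integrable_intervalIntegral_of_prod hT
      (integrable_uncurry_continuousOn_mul (by fun_prop) hk)), integral_const_mul, mul_comm]
  · simp only [phiPath_mul_eq hw ht]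
    rw [integral_add (hg.const_mul _) (integrable_intervalIntegral_of_prod ht.1
      (integrable_uncurry_restrict_Ioc_of_le hk ht.2)), integral_const_mul, mul_comm]

end PhiFubini

section Processes

variable {Ω : Type*} [MeasurableSpace Ω] {P : Measure Ω} {H₁ H₂ T : ℝ} {W B : ℝ → Ω → ℝ}

theorem exists_pos_lt_of_one_lt_add (h₁ : 0 < H₁) (h₂ : 0 < H₂) (h : 1 < H₁ + H₂) :
    ∃ α β : ℝ≥0, 0 < α ∧ α < H₁ ∧ 0 < β ∧ β < H₂ ∧ 1 < α + β := by
  obtain ⟨α, hα, hαH⟩ := exists_between (max_lt h₁ (by linarith : 1 - H₂ < H₁))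
  obtain ⟨hα0, hα1⟩ := max_lt_iff.1 hα
  obtain ⟨β, hβ, hβH⟩ := exists_between (max_lt h₂ (by linarith : 1 - α < H₂))
  obtain ⟨hβ0, hβ1⟩ := max_lt_iff.1 hβ
  lift α to ℝ≥0 using hα0.le
  lift β to ℝ≥0 using hβ0.le
  exact ⟨α, β, mod_cast hα0, hαH, mod_cast hβ0, hβH, mod_cast (by linarith : (1 : ℝ) < α + β)⟩

theorem IsFractionalBrownianMotionOn.ae_rsIntegrable (hW : IsFractionalBrownianMotionOn W H₁ T P)
    (hB : IsFractionalBrownianMotionOn B H₂ T P) (hT : 0 < T) (h₁ : 0 < H₁) (h₂ : 0 < H₂)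
    (h : 1 < H₁ + H₂) :
    ∀ᵐ ω ∂P, RSIntegrable (fun t => (W t ω : ℂ)) (fun t => B t ω) 0 T := by
  obtain ⟨α, β, hα, hαH, hβ, hβH, hαβ⟩ := exists_pos_lt_of_one_lt_add h₁ h₂ h
  filter_upwards [hW.ae_exists_holderOnWith hT hα hαH, hB.ae_exists_holderOnWith hT hβ hβH]
    with ω ⟨A, hA⟩ ⟨C, hC⟩
  have hA' : HolderOnWith (1 * A ^ (1 : ℝ)) (1 * α) (fun t => (W t ω : ℂ)) (Icc 0 T) := by
    exact (holderWith_one.2 Complex.isometry_ofReal.lipschitz).comp_holderOnWith hA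
  exact rsIntegrable_of_holderOnWith hT.le (by simpa) hβ (by simpa) hA' hC

theorem integrable_ofReal_mul_density {E : Type*} [MeasurableSpace E] {ν : Measure E} {ξ : Ω → E}
    {g F : E → ℝ} (hg : Measurable g) (hg0 : ∀ x, 0 ≤ g x)
    (hξg : HasLaw ξ (ν.withDensity fun x => ENNReal.ofReal (g x)) P) (hF : Measurable F)
    (hFξ : Integrable (fun ω => F (ξ ω)) P) : Integrable (fun x => (F x : ℂ) * (g x : ℂ)) ν := by
  have hlaw : Integrable F (P.map ξ) :=
    (integrable_map_measure hF.aestronglyMeasurable hξg.aemeasurable).2 hFξ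
  rw [hξg.map_eq, integrable_withDensity_iff hg.ennreal_ofReal
    (.of_forall fun _ => ENNReal.ofReal_lt_top)] at hlaw
  simpa only [ENNReal.toReal_ofReal (hg0 _), Complex.coe_algebraMap, Complex.ofReal_mul]
    using! hlaw.ofReal (𝕜 := ℂ)

end Processes

theorem proposition2p7_general {Ω : Type*} [MeasurableSpace Ω] {P : Measure Ω} {T : ℝ} (hT : 0 < T)
    {H₁ H₂ : ℝ} (h₁ : 0 < H₁) (h₂ : 0 < H₂) (h : 1 < H₁ + H₂) {W B : ℝ → Ω → ℝ}
    (hW : IsFractionalBrownianMotionOn W H₁ T P) (hB : IsFractionalBrownianMotionOn B H₂ T P)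
    {μ : Measure ℝ} [SFinite μ] {g : ℝ → ℂ} (hg : Integrable g μ)
    (hg2 : Integrable (fun x : ℝ => (x : ℂ) ^ 2 * g x) μ) :
    ∀ᵐ ω ∂P,
      (∀ t ∈ Icc (0 : ℝ) T, ∀ x : ℝ,
        HasRSIntegral (fun s => Complex.exp (Complex.I * x * (t - s))) (fun s => W s ω) 0 t
          (phiPath (fun s => W s ω) t x)) ∧
      (∀ x : ℝ, RSIntegrable (fun t => phiPath (fun s => W s ω) t x) (fun t => B t ω) 0 T) ∧
      Integrable (fun x : ℝ =>
        rsIntegral (fun t => phiPath (fun s => W s ω) t x) (fun t => B t ω) 0 T * g x) μ ∧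
      (∀ t ∈ Icc (0 : ℝ) T, Integrable (fun x : ℝ => phiPath (fun s => W s ω) t x * g x) μ) ∧
      RSIntegrable (fun t => ∫ x : ℝ, phiPath (fun s => W s ω) t x * g x ∂μ)
        (fun t => B t ω) 0 T ∧
      (∫ x : ℝ, rsIntegral (fun t => phiPath (fun s => W s ω) t x) (fun t => B t ω) 0 T * g x ∂μ)
        = rsIntegral (fun t => ∫ x : ℝ, phiPath (fun s => W s ω) t x * g x ∂μ)
            (fun t => B t ω) 0 T := by
  filter_upwards [hW.continuous, hB.continuous, hW.ae_zero hT.le h₁.ne',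
    hW.ae_rsIntegrable hB hT h₁ h₂ h] with ω hw hb hw0 hwb
  have hφ := hasRSIntegral_integral_phiPath_mul hT.le hw hb hwb hg hg2
  exact ⟨fun t ht x => hasRSIntegral_phiPath ht.1 (hw.mono (Icc_subset_Icc_right ht.2)) hw0 x,
    fun x => ⟨_, hasRSIntegral_phiPath_right hT.le hw hb hwb x⟩,
    integrable_rsIntegral_phiPath_mul hT.le hw hb hwb hg hg2,
    fun t ht => integrable_phiPath_mul hw hg hg2 ht, ⟨_, hφ⟩, (hφ.rsIntegral_eq hT.le).symm⟩

theorem proposition2p7 {Ω : Type*} [MeasurableSpace Ω] (P : Measure Ω) [IsProbabilityMeasure P]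
    (T : ℝ) (hT : 0 < T) (H : ℝ) (hH : H ∈ Ioo (1 / 2 : ℝ) 1)
    (W B : ℝ → Ω → ℝ)
    (hW : IsStandardBrownianMotionOn W T P)
    (hB : IsFractionalBrownianMotionOn B H T P)
    (hWB : IndepFun (fun ω (t : Icc (0 : ℝ) T) => W t ω) (fun ω (t : Icc (0 : ℝ) T) => B t ω) P)
    (ξ : Ω → ℝ) (hξ : MemLp ξ 2 P)
    (g : ℝ → ℝ) (hg : Measurable g) (hg0 : ∀ x, 0 ≤ g x)
    (hξg : HasLaw ξ (volume.withDensity fun x => ENNReal.ofReal (g x)) P)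
    (hξX : IndepFun ξ (fun ω (t : Icc (0 : ℝ) T) => W t ω + B t ω) P) :
    ∀ᵐ ω ∂P,
      -- `φ_W(t,x)` is the limit of the Riemann–Stieltjes sums of `∫₀ᵗ e^{ix(t-s)} dW_s`
      (∀ t ∈ Icc (0 : ℝ) T, ∀ x : ℝ,
        HasRSIntegral (fun s => Complex.exp (Complex.I * x * (t - s))) (fun s => W s ω) 0 t
          (phiPath (fun s => W s ω) t x)) ∧
      -- the iterated integral `I₁` exists
      (∀ x : ℝ, RSIntegrable (fun t => phiPath (fun s => W s ω) t x) (fun t => B t ω) 0 T) ∧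
      Integrable (fun x : ℝ =>
        rsIntegral (fun t => phiPath (fun s => W s ω) t x) (fun t => B t ω) 0 T * (g x : ℂ)) ∧
      -- the iterated integral `I₂` exists
      (∀ t ∈ Icc (0 : ℝ) T,
        Integrable (fun x : ℝ => phiPath (fun s => W s ω) t x * (g x : ℂ))) ∧
      RSIntegrable (fun t => ∫ x : ℝ, phiPath (fun s => W s ω) t x * (g x : ℂ))
        (fun t => B t ω) 0 T ∧
      -- `I₁ = I₂`
      (∫ x : ℝ, rsIntegral (fun t => phiPath (fun s => W s ω) t x) (fun t => B t ω) 0 T * (g x : ℂ))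
        = rsIntegral (fun t => ∫ x : ℝ, phiPath (fun s => W s ω) t x * (g x : ℂ))
            (fun t => B t ω) 0 T := by
  exact proposition2p7_general hT one_half_pos (one_half_pos.trans hH.1) (by linarith [hH.1])
    hW.isFractionalBrownianMotionOn hB
    (by simpa using integrable_ofReal_mul_density hg hg0 hξg measurable_const (integrable_const 1))
    (by simpa using
      integrable_ofReal_mul_density hg hg0 hξg (measurable_id.pow_const 2) hξ.integrable_sq)
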